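/- Let $p$ be a prime, $S$ a finite $p$-group and $\mathcal F$ a saturated fusion system on $S$ (for instance the one underlying a $p$-local finite group $(S,\mathcal F,\mathcal L)$). Let $P_1=S,P_2,\dots,P_n$ be $\mathcal F$-centric subgroups of $S$ such that every $\mathcal F$-essential subgroup of $S$ is $\mathcal F$-conjugate to some $P_i$; here $P\le S$ is $\mathcal F$-essential if it is $\mathcal F$-centric and $\mathrm{Out}_{\mathcal F}(P)=\mathrm{Aut}_{\mathcal F}(P)/\mathrm{Inn}(P)$ has a strongly $p$-embedded subgroup. (For example, the $P_i$ may be representatives of the conjugacy classes of all $\mathcal F$-centric subgroups, of all $\mathcal F$-centric radical subgroups, or $S$ together with representatives of the $\mathcal F$-essential subgroups.) Let $L_1,\dots,L_n$ be finite groups with embeddings $N_S(P_i)\le L_i$ such that, for each $i$, $N_S(P_i)$ is a Sylow $p$-subgroup of $L_i$, $P_i=O_p(L_i)$ (the largest normal $p$-subgroup), $C_{L_i}(P_i)=Z(P_i)$, $L_i/P_i\cong\mathrm{Out}_{\mathcal F}(P_i)$ and $\mathcal F_{N_S(P_i)}(L_i)\subseteq\mathcal F$, and such that $\mathcal F$ is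 generated by the $\mathcal F_{N_S(P_i)}(L_i)$. (So $L_1\ast_{N_S(P_2)}L_2\ast_{N_S(P_3)}\cdots\ast_{N_S(P_n)}L_n$ is a model of Robinson type for $\mathcal F$.) For each $i$ choose subgroups $K_{i,1},\dots,K_{i,m_i}$ of $L_i$ that all contain the given subgroup $N_S(P_i)$ and that together generate $L_i$. List all the $K_{i,j}$ in some order as $K_1,\dots,K_N$, where $K_k\le L_{i(k)}$, so that $S$ is a Sylow $p$-subgroup of $K_1$, i.e. $N_S(P_{i(1)})=S$. Let $$G=K_1\ast_{N_S(P_{i(2)})}K_2\ast_{N_S(P_{i(3)})}\cdots\ast_{N_S(P_{i(N)})}K_N$$ be the iterated amalgam, where at the $k$-th step $N_S(P_{i(k)})$ is mapped to $K_k$ by the given inclusion and to the group already constructed by way of $N_S(P_{i(k)})\le S\le K_1$. Then $S$ embeds in $G$ through $K_1$, it is a Sylow $p$-subgroup of $G$ (that is, a finite $p$-subgroup such that every $p$-subgroup of $G$ is conjugate in $G$ to a subgroup of $S$), and $\mathcal F_S(G)=\mathcal F$, where the morphisms $P\to Q$ of $\mathcal F_S(G)$, for $P,Q\le S$, are the conjugations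 $x\mapsto gxg^{-1}$ by those $g\in G$ with $gPg^{-1}\le Q$. -/

import Mathlib

universe u

/-! ### Fusion systems on a group -/

/-- The homomorphism `c_g : P → Q`, `x ↦ g x g⁻¹`, for `g` with `g P g⁻¹ ≤ Q`. -/
def conjHom {S : Type u} [Group S] (P Q : Subgroup S) (g : S)
    (h : ∀ x ∈ P, g * x * g⁻¹ ∈ Q) : P →* Q :=
  ((MulAut.conj g).toMonoidHom.comp P.subtype).codRestrict Q (fun x => h x.1 x.2)

/-- A fusion system on `S`: a category whose objects are the subgroups of `S`, with morphism sets
`Hom P Q` made of injective homomorphisms, containing all conjugations by elements of `S`, in which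
each morphism is an isomorphism of the category followed by an inclusion. (Identities and
inclusions are conjugations by `1`.) -/
@[ext]
structure FusionSystem (S : Type u) [Group S] where
  Hom : ∀ P Q : Subgroup S, Set (P →* Q)
  injective : ∀ {P Q : Subgroup S} {φ : P →* Q}, φ ∈ Hom P Q → Function.Injective φ
  conj_mem : ∀ (P Q : Subgroup S) (g : S) (h : ∀ x ∈ P, g * x * g⁻¹ ∈ Q),
    conjHom P Q g h ∈ Hom P Q
  comp_mem : ∀ {P Q R : Subgroup S} {φ : P →* Q} {ψ : Q →* R},
    φ ∈ Hom P Q → ψ ∈ Hom Q R → ψ.comp φ ∈ Hom P R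
  factor : ∀ {P Q : Subgroup S} {φ : P →* Q}, φ ∈ Hom P Q →
    ∃ (R : Subgroup S) (hRQ : R ≤ Q) (e : P ≃* R), e.toMonoidHom ∈ Hom P R ∧
      e.symm.toMonoidHom ∈ Hom R P ∧ φ = (Subgroup.inclusion hRQ).comp e.toMonoidHom

/-- `N_S(P)`. -/
abbrev nrm {S : Type u} [Group S] (P : Subgroup S) : Subgroup S :=
  Subgroup.normalizer (P : Set S)

/-- The group of inner automorphisms. -/
def innerAut (G : Type u) [Group G] : Subgroup (MulAut G) := (MulAut.conj : G →* MulAut G).range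

instance innerAut_normal (G : Type u) [Group G] : (innerAut G).Normal where
  conj_mem := by
    rintro _ ⟨g, rfl⟩ a
    refine ⟨a g, ?_⟩
    ext x
    simp [MulAut.conj_apply]

/-- A subgroup `H` of a finite group is strongly `p`-embedded: it is proper, its order is divisible
by `p`, and `H ∩ g H g⁻¹` has order prime to `p` for every `g` outside `H`. -/
def IsStronglyEmbedded (p : ℕ) {G : Type u} [Group G] (H : Subgroup G) : Prop :=
  H ≠ ⊤ ∧ p ∣ Nat.card H ∧
    ∀ g : G, g ∉ H → ¬ p ∣ Nat.card (H ⊓ H.map (MulAut.conj g).toMonoidHom : Subgroup G)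

namespace FusionSystem

/-- `F` is contained in `F'`. -/
def Le {S : Type u} [Group S] (F F' : FusionSystem S) : Prop :=
  ∀ P Q : Subgroup S, F.Hom P Q ⊆ F'.Hom P Q

/-- `P` and `Q` are isomorphic in `F`. -/
def Conj {S : Type u} [Group S] (F : FusionSystem S) (P Q : Subgroup S) : Prop :=
  ∃ e : P ≃* Q, e.toMonoidHom ∈ F.Hom P Q ∧ e.symm.toMonoidHom ∈ F.Hom Q P

/-- `Aut_F(P)`. -/
def aut {S : Type u} [Group S] (F : FusionSystem S) (P : Subgroup S) : Subgroup (MulAut P) where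
  carrier := {a | MulEquiv.toMonoidHom a ∈ F.Hom P P ∧
    MulEquiv.toMonoidHom (MulEquiv.symm a) ∈ F.Hom P P}
  one_mem' := by
    have h : conjHom P P 1 (by simp) = MonoidHom.id P := by
      ext x; simp [conjHom]
    have h' := F.conj_mem P P 1 (by simp)
    rw [h] at h'
    exact ⟨h', h'⟩
  mul_mem' := fun {a b} ha hb => ⟨F.comp_mem hb.1 ha.1, F.comp_mem ha.2 hb.2⟩
  inv_mem' := fun {a} ha => ⟨ha.2, ha.1⟩

/-- `Out_F(P) = Aut_F(P) / Inn(P)`. -/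
abbrev Out {S : Type u} [Group S] (F : FusionSystem S) (P : Subgroup S) : Type u :=
  F.aut P ⧸ (innerAut P).subgroupOf (F.aut P)

/-- `Aut_S(P)`, the automorphisms of `P` induced by `N_S(P)`. -/
def autS {S : Type u} [Group S] (P : Subgroup S) : Subgroup (MulAut P) :=
  P.normalizerMonoidHom.range

def IsFullyCentralized {S : Type u} [Group S] (F : FusionSystem S) (P : Subgroup S) : Prop :=
  ∀ P' : Subgroup S, F.Conj P P' →
    Nat.card (Subgroup.centralizer (P' : Set S)) ≤ Nat.card (Subgroup.centralizer (P : Set S))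

def IsFullyNormalized {S : Type u} [Group S] (F : FusionSystem S) (P : Subgroup S) : Prop :=
  ∀ P' : Subgroup S, F.Conj P P' → Nat.card (nrm P') ≤ Nat.card (nrm P)

/-- The image `φ(P)` as a subgroup of `S`. -/
def image {S : Type u} [Group S] {P Q : Subgroup S} (φ : P →* Q) : Subgroup S :=
  (Q.subtype.comp φ).range

/-- `N_φ = {g ∈ N_S(P) | φ c_g φ⁻¹ ∈ Aut_S(φ(P))}`: the automorphism `φ c_g φ⁻¹` of `φ(P)`
is conjugation by some `h ∈ N_S(φ(P))`. -/
def extender {S : Type u} [Group S] {P Q : Subgroup S} (φ : P →* Q) : Subgroup S where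
  carrier := {g | ∃ hg : g ∈ nrm P, ∃ h ∈ nrm (image φ), ∀ x : P,
    ((φ (P.normalizerMonoidHom ⟨g, hg⟩ x) : Q) : S) = h * (φ x : S) * h⁻¹}
  one_mem' := ⟨one_mem _, 1, one_mem _, fun x => by
    have h1 : (⟨1, one_mem _⟩ : nrm P) = 1 := rfl
    rw [h1, map_one]; simp⟩
  mul_mem' := by
    rintro a b ⟨ha, h, hh, hx⟩ ⟨hb, k, hk, hy⟩
    refine ⟨mul_mem ha hb, h * k, mul_mem hh hk, fun x => ?_⟩
    have h1 : (⟨a * b, mul_mem ha hb⟩ : nrm P) = ⟨a, ha⟩ * ⟨b, hb⟩ := rfl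
    rw [h1, map_mul, MulAut.mul_apply, hx, hy]
    simp [mul_assoc]
  inv_mem' := by
    rintro a ⟨ha, h, hh, hx⟩
    refine ⟨inv_mem ha, h⁻¹, inv_mem hh, fun x => ?_⟩
    have h1 : (⟨a⁻¹, inv_mem ha⟩ : nrm P) = (⟨a, ha⟩ : nrm P)⁻¹ := rfl
    have h2 := hx ((P.normalizerMonoidHom ⟨a, ha⟩)⁻¹ x)
    rw [MulAut.apply_inv_self] at h2
    rw [h1, map_inv, h2]
    simp [mul_assoc]

/-- Saturation of a fusion system on a finite `p`-group. -/
structure IsSaturated {S : Type u} [Group S] (F : FusionSystem S) (p : ℕ) : Prop where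
  fully_centralized : ∀ P : Subgroup S, F.IsFullyNormalized P → F.IsFullyCentralized P
  sylow : ∀ P : Subgroup S, F.IsFullyNormalized P →
    ∃ T : Sylow p (F.aut P), (T : Subgroup (F.aut P)) = (autS P).subgroupOf (F.aut P)
  extend : ∀ (P : Subgroup S) (φ : P →* (⊤ : Subgroup S)), φ ∈ F.Hom P ⊤ →
    F.IsFullyCentralized (image φ) →
      ∃ ψ ∈ F.Hom (extender φ) ⊤, ∀ (x : S) (hx : x ∈ P) (hx' : x ∈ extender φ),
        ψ ⟨x, hx'⟩ = φ ⟨x, hx⟩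

/-- `P` is `F`-centric. -/
def IsCentric {S : Type u} [Group S] (F : FusionSystem S) (P : Subgroup S) : Prop :=
  ∀ P' : Subgroup S, F.Conj P P' → Subgroup.centralizer (P' : Set S) ≤ P'

/-- `P` is `F`-essential: `F`-centric, and `Out_F(P)` has a strongly `p`-embedded subgroup. -/
def IsEssential {S : Type u} [Group S] (F : FusionSystem S) (p : ℕ) (P : Subgroup S) : Prop :=
  F.IsCentric P ∧ ∃ H : Subgroup (F.Out P), IsStronglyEmbedded p H

/-- The fusion system `F_S(G)` of a group `G` that contains `S` (through the embedding `ι`): the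
morphisms `P → Q` are the homomorphisms that are conjugation by some `g ∈ G`. -/
def ofGroup {S G : Type u} [Group S] [Group G] (ι : S →* G) (hι : Function.Injective ι) :
    FusionSystem S where
  Hom P Q := {φ | ∃ g : G, ∀ x : P, ι (φ x) = g * ι x * g⁻¹}
  injective := by
    rintro P Q φ ⟨g, hg⟩ x y hxy
    have h : g * ι x * g⁻¹ = g * ι y * g⁻¹ := by rw [← hg, ← hg, hxy]
    exact Subtype.ext (hι (mul_left_cancel (mul_right_cancel h)))
  conj_mem := fun P Q g h => ⟨ι g, fun x => by simp [conjHom]⟩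
  comp_mem := by
    rintro P Q R φ ψ ⟨g, hg⟩ ⟨k, hk⟩
    refine ⟨k * g, fun x => ?_⟩
    rw [MonoidHom.comp_apply, hk, hg]
    simp [mul_assoc]
  factor := by
    rintro P Q φ ⟨g, hg⟩
    have hinj : Function.Injective (Q.subtype.comp φ) := by
      intro x y hxy
      have h0 : ((φ x : Q) : S) = φ y := hxy
      have h : g * ι x * g⁻¹ = g * ι y * g⁻¹ := by rw [← hg, ← hg, h0]
      exact Subtype.ext (hι (mul_left_cancel (mul_right_cancel h)))
    refine ⟨(Q.subtype.comp φ).range, ?_, MonoidHom.ofInjective hinj, ⟨g, hg⟩, ⟨g⁻¹, ?_⟩, ?_⟩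
    · rintro _ ⟨x, rfl⟩
      exact (φ x).2
    · intro y
      obtain ⟨x, rfl⟩ := (MonoidHom.ofInjective hinj).surjective y
      have h1 : (((MonoidHom.ofInjective hinj) x : (Q.subtype.comp φ).range) : S) = φ x := rfl
      rw [h1, hg]
      simp [mul_assoc]
    · ext x
      rfl

end FusionSystem

/-- For a subgroup `N` of `S` embedded in a group `L` by `θ`, the morphisms of `F_N(L)` between
subgroups `Q, R ≤ N` of `S`. -/
def subgroupFusion {S L : Type u} [Group S] [Group L] {N : Subgroup S} (θ : N →* L)
    (Q R : Subgroup S) : Set (Q →* R) :=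
  {φ | ∃ (hQ : Q ≤ N) (hR : R ≤ N) (g : L), ∀ x : Q,
    θ ⟨φ x, hR (φ x).2⟩ = g * θ ⟨x, hQ x.2⟩ * g⁻¹}

/-- `T` is a Sylow `p`-subgroup of the (possibly infinite) discrete group `G`. -/
def IsSylowSubgroup (p : ℕ) {G : Type u} [Group G] (T : Subgroup G) : Prop :=
  Finite T ∧ IsPGroup p T ∧
    ∀ Q : Subgroup G, IsPGroup p Q → ∃ g : G, ∀ x ∈ Q, g * x * g⁻¹ ∈ T

/-- `N = O_p(L)`, the largest normal `p`-subgroup. -/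
structure IsPCore (p : ℕ) {L : Type u} [Group L] (N : Subgroup L) : Prop where
  normal : N.Normal
  isPGroup : IsPGroup p N
  le : ∀ M : Subgroup L, M.Normal → IsPGroup p M → M ≤ N

/-- The copy of `P` inside `L`, for an embedding `θ : N_S(P) → L`. -/
def copyIn {S L : Type u} [Group S] [Group L] (P : Subgroup S) (θ : nrm P →* L) : Subgroup L :=
  (P.subgroupOf (nrm P)).map θ

/-- Subgroups `P_i` of `S` and finite groups `L_i`, each containing `N_S(P_i)` (through `θ_i`), that
exhibit `F` as an Alperin fusion system; the index `0` is that of `P_1 = S`. -/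
structure IsAlperinFamily (p : ℕ) {S : Type u} [Group S] (F : FusionSystem S) {n : ℕ} [NeZero n]
    (P : Fin n → Subgroup S) (L : Fin n → Type u) [∀ i, Group (L i)]
    (θ : ∀ i, nrm (P i) →* L i) : Prop where
  first : P 0 = ⊤
  finite : ∀ i, Finite (L i)
  injective : ∀ i, Function.Injective (θ i)
  isPCore : ∀ i, IsPCore p (copyIn (P i) (θ i))
  centralizer_eq : ∀ i, Subgroup.centralizer (copyIn (P i) (θ i) : Set (L i)) =
    (Subgroup.center (copyIn (P i) (θ i))).map (copyIn (P i) (θ i)).subtype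
  quotient_iso : ∀ i, ∃ _ : (copyIn (P i) (θ i)).Normal,
    Nonempty ((L i ⧸ copyIn (P i) (θ i)) ≃* F.Out (P i))
  sylow : ∀ i, ∃ T : Sylow p (L i), (T : Subgroup (L i)) = (θ i).range
  fusion_le : ∀ i (Q R : Subgroup S), subgroupFusion (θ i) Q R ⊆ F.Hom Q R
  generated : ∀ F' : FusionSystem S,
    (∀ i (Q R : Subgroup S), subgroupFusion (θ i) Q R ⊆ F'.Hom Q R) → F.Le F'

/-- The data of a model of Robinson type for `F`: an Alperin family whose subgroups `P_i` are
`F`-centric and represent all conjugacy classes of `F`-essential subgroups. (The `P_i` may be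
representatives of all `F`-centric subgroups, of all `F`-centric radical subgroups, or `S` together
with representatives of the `F`-essential subgroups.) -/
structure IsRobinsonFamily (p : ℕ) {S : Type u} [Group S] (F : FusionSystem S) {n : ℕ} [NeZero n]
    (P : Fin n → Subgroup S) (L : Fin n → Type u) [∀ i, Group (L i)]
    (θ : ∀ i, nrm (P i) →* L i) : Prop extends IsAlperinFamily p F P L θ where
  centric : ∀ i, F.IsCentric (P i)
  essential : ∀ Q : Subgroup S, F.IsEssential p Q → ∃ i, F.Conj Q (P i)

/-! ### Iterated amalgams -/

/-- A group together with a homomorphism from `S`. -/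
structure GroupUnder (S : Type u) [Group S] where
  carrier : Type u
  [grp : Group carrier]
  ι : S →* carrier

attribute [instance] GroupUnder.grp

/-- The two factors of an amalgam. -/
def AmalgFactor (A K : Type u) : Bool → Type u
  | false => A
  | true => K

instance AmalgFactor.group (A K : Type u) [Group A] [Group K] : ∀ b, Group (AmalgFactor A K b)
  | false => inferInstanceAs (Group A)
  | true => inferInstanceAs (Group K)

/-- The two maps along which one amalgamates. -/
def amalgMap {N A K : Type u} [Group N] [Group A] [Group K] (α : N →* A) (θ : N →* K) :
    ∀ b, N →* AmalgFactor A K b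
  | false => α
  | true => θ

/-- The amalgam `A *_N K`, for `N ≤ S` mapping to `A` through `S` and to `K` by `θ`. -/
def GroupUnder.amalgam {S : Type u} [Group S] (A : GroupUnder S) {N : Subgroup S} {K : Type u}
    [Group K] (θ : N →* K) : GroupUnder S where
  carrier := Monoid.PushoutI (amalgMap (A.ι.comp N.subtype) θ)
  ι := (Monoid.PushoutI.of (φ := amalgMap (A.ι.comp N.subtype) θ) false).comp A.ι

/-- The iterated amalgam `(⋯((A *_{N_0} K_0) *_{N_1} K_1) ⋯) *_{N_{r-1}} K_{r-1}`. -/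
def GroupUnder.iteratedAmalgam {S : Type u} [Group S] (A : GroupUnder S) :
    ∀ {r : ℕ} {N : Fin r → Subgroup S} {K : Fin r → Type u} [∀ k, Group (K k)]
      (_ : ∀ k, N k →* K k), GroupUnder S
  | 0, _, _, _, _ => A
  | _ + 1, _, _, _, θ =>
    (A.iteratedAmalgam (fun k => θ (Fin.castSucc k))).amalgam (θ (Fin.last _))

/-- The embedding of `N` in a subgroup `K` of `L` that contains it. -/
def toSubgroupHom {N L : Type u} [Group N] [Group L] (θ : N →* L) (K : Subgroup L)
    (h : θ.range ≤ K) : N →* K :=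
  θ.codRestrict K (fun x => h ⟨x, rfl⟩)

/-- A group `K` containing a subgroup `N = S`, as a group under `S`. -/
def GroupUnder.ofTop {S : Type u} [Group S] {N : Subgroup S} (hN : N = ⊤) {K : Type u} [Group K]
    (θ : N →* K) : GroupUnder S where
  carrier := K
  ι := θ.comp ((MonoidHom.id S).codRestrict N (fun s => hN ▸ Subgroup.mem_top s))

/-- The group `G = K_1 *_{N_S(P_2)} K_2 * ⋯ * K_{r+1}`, where `e` lists the chosen subgroups
`K i j ≤ L i` in an order that begins with a subgroup that contains `S`. -/
def robinsonAmalgam {S : Type u} [Group S] {n : ℕ} (P : Fin n → Subgroup S) (L : Fin n → Type u)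
    [∀ i, Group (L i)] (θ : ∀ i, nrm (P i) →* L i) {m : Fin n → ℕ}
    (K : ∀ i, Fin (m i) → Subgroup (L i)) (hK : ∀ i j, (θ i).range ≤ K i j)
    {r : ℕ} (e : Fin (r + 1) ≃ Σ i, Fin (m i)) (he : nrm (P (e 0).1) = ⊤) : GroupUnder S :=
  (GroupUnder.ofTop he (toSubgroupHom (θ (e 0).1) (K (e 0).1 (e 0).2) (hK _ _))).iteratedAmalgam
    (N := fun k : Fin r => nrm (P (e k.succ).1))
    (K := fun k : Fin r => K (e k.succ).1 (e k.succ).2)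
    (fun k => toSubgroupHom (θ (e k.succ).1) (K (e k.succ).1 (e k.succ).2) (hK _ _))

/-! The embedding of `S`, the Sylow property and the inclusion of `F_S(G)` in `F` are proved for a
single amalgam `A *_N K` with `N ≤ S`, and pass to the iterated one by induction. They rest on
reduced expressions, whose sequence of factors is unique (`IsAmalgam`).

Sylow property: a reduced expression of a torsion element outside `N` begins and ends in the same
factor, since otherwise its powers would stay reduced and never become trivial. Cyclic reduction
then conjugates the element into a factor, and a comparison of lengths does the same for a whole
torsion subgroup when `N` is finite (`IsAmalgam.exists_conj_le`). So a `p`-subgroup lies, up to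
conjugacy, in `A` or in `K`, where `S` or `N ≤ S` is Sylow.

`F_S(G) ≤ F`: when `P` and `g P g⁻¹` both lie in `S`, uniqueness of reduced expressions forces the
intermediate conjugates of `P`, taken syllable by syllable, to lie in `N`. Conjugation by `g` is
therefore a composite of conjugations inside the factors (`FusionSystem.mem_hom_of_isAmalgam`).

`F ≤ F_S(G)`: the `K i j` generate `L i`, but a product of their elements may carry a subgroup of
`N_S(P i)` out of `N_S(P i)` along the way. It never moves `P i`, which is normal in `L i`. So
`F_S(G)` contains the automorphisms of `P i` induced by `L i`, and these are all of `Aut_F(P i)` by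
a count of orders (`conjAut_range`). That these groups generate `F` is the Alperin–Goldschmidt
theorem (`FusionSystem.IsSaturated.le_of_aut_le`). The `P i` need not be fully normalized for it:
`Aut_S(P i)` is Sylow in `Aut_F(P i)` because `N_S(P i)` is Sylow in `L i`, and centric subgroups
are fully centralized. -/

/-! ### Reduced expressions in an amalgam -/

section Alternating

variable {G : Type*} {ι : Type*} [Group G]

/-- `Alternating N B l g` says that `g = x₁ ⋯ x_k n` with `x_j ∈ B i_j` outside `N`, where
`l = [i₁, …, i_k]` has no two equal neighbours, and `n ∈ N`. -/
inductive Alternating (N : Subgroup G) (B : ι → Subgroup G) : List ι → G → Prop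
  | nil {n : G} (hn : n ∈ N) : Alternating N B [] n
  | cons {i : ι} {l : List ι} {x g : G} (hx : x ∈ B i) (hxN : x ∉ N) (hl : i ∉ l.head?)
      (hg : Alternating N B l g) : Alternating N B (i :: l) (x * g)

/-- `G` behaves like the amalgam of its subgroups `B i` over `N`: each element has a reduced
expression, and the sequence of factors it uses is unique. -/
structure IsAmalgam (N : Subgroup G) (B : ι → Subgroup G) : Prop where
  le : ∀ i, N ≤ B i
  exists_alternating : ∀ g, ∃ l, Alternating N B l g
  unique : ∀ {l l' g}, Alternating N B l g → Alternating N B l' g → l = l'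

namespace Alternating

variable {N : Subgroup G} {B : ι → Subgroup G}

theorem mem_of_nil {g : G} (h : Alternating N B [] g) : g ∈ N := by
  cases h; assumption

theorem exists_of_cons {i : ι} {l : List ι} {g : G} (h : Alternating N B (i :: l) g) :
    ∃ x ∈ B i, x ∉ N ∧ i ∉ l.head? ∧ ∃ g', Alternating N B l g' ∧ g = x * g' := by
  cases h with
  | cons hx hxN hl hg => exact ⟨_, hx, hxN, hl, _, hg, rfl⟩

theorem single {i : ι} {x : G} (hx : x ∈ B i) (hxN : x ∉ N) :
    Alternating N B [i] x := by
  simpa using Alternating.cons (l := []) hx hxN (by simp) (.nil (one_mem N) : Alternating N B [] _)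

theorem mul_left (hB : ∀ i, N ≤ B i) {l : List ι} {g n : G} (hn : n ∈ N)
    (h : Alternating N B l g) : Alternating N B l (n * g) := by
  cases h with
  | nil h => exact .nil (mul_mem hn h)
  | cons hx hxN hl hg =>
    rw [← mul_assoc]
    exact .cons (mul_mem (hB _ hn) hx) (by rwa [Subgroup.mul_mem_cancel_left _ hn]) hl hg

theorem append (hB : ∀ i, N ≤ B i) {l l' : List ι} {g g' : G} (h : Alternating N B l g)
    (h' : Alternating N B l' g') (hll : ∀ i ∈ l.getLast?, i ∉ l'.head?) :
    Alternating N B (l ++ l') (g * g') := by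
  induction h with
  | nil hn => exact mul_left hB hn h'
  | @cons i l x g hx hxN hl hg ih =>
    rw [mul_assoc, List.cons_append]
    cases l with
    | nil =>
      refine .cons hx hxN ?_ (ih (by simp))
      simpa using hll i (by simp)
    | cons j l =>
      refine .cons hx hxN (by simpa using hl) (ih ?_)
      simpa [List.getLast?_cons_cons] using hll

theorem inv (hB : ∀ i, N ≤ B i) {l : List ι} {g : G} (h : Alternating N B l g) :
    Alternating N B l.reverse g⁻¹ := by
  induction h with
  | nil hn => exact .nil (inv_mem hn)
  | @cons i l x g hx hxN hl hg ih =>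
    rw [mul_inv_rev, List.reverse_cons]
    refine ih.append hB (single (inv_mem hx) (by simpa using hxN)) ?_
    rintro j hj
    simp only [List.getLast?_reverse] at hj
    simp only [List.head?_cons, Option.mem_def, Option.some.injEq]
    rintro rfl
    exact hl hj

theorem exists_of_concat (hB : ∀ i, N ≤ B i) {i : ι} {l : List ι} {g : G}
    (h : Alternating N B (l ++ [i]) g) :
    ∃ x ∈ B i, x ∉ N ∧ i ∉ l.getLast? ∧ ∃ g', Alternating N B l g' ∧ g = g' * x := by
  have h1 := h.inv hB
  rw [List.reverse_append] at h1
  obtain ⟨x, hx, hxN, hl, g', hg', he⟩ := exists_of_cons h1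
  refine ⟨x⁻¹, inv_mem hx, by simpa using hxN, by simpa using hl, g'⁻¹, ?_, ?_⟩
  · simpa using hg'.inv hB
  · rw [← mul_inv_rev, ← he, inv_inv]

theorem mul_right (hB : ∀ i, N ≤ B i) {l : List ι} {g n : G} (hn : n ∈ N)
    (h : Alternating N B l g) : Alternating N B l (g * n) := by
  simpa using h.append hB (.nil hn) (by simp)

theorem mem_of_single (hB : ∀ i, N ≤ B i) {i : ι} {g : G} (h : Alternating N B [i] g) :
    g ∈ B i := by
  obtain ⟨x, hx, -, -, g', hg', rfl⟩ := exists_of_cons h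
  exact mul_mem hx (hB i hg'.mem_of_nil)

theorem exists_pow (hB : ∀ i, N ≤ B i) {l : List ι} {g : G} (h : Alternating N B l g)
    (hl : ∀ i ∈ l.getLast?, i ∉ l.head?) (k : ℕ) :
    ∃ l', Alternating N B (l ++ l') (g ^ (k + 1)) := by
  induction k with
  | zero => exact ⟨[], by simpa using h⟩
  | succ k ih =>
    obtain ⟨l', hl'⟩ := ih
    refine ⟨l ++ l', ?_⟩
    rw [pow_succ']
    refine h.append hB hl' ?_
    cases l with
    | nil => simp
    | cons i l => simpa using hl

end Alternating

/-! ### Torsion elements and torsion subgroups of an amalgam. -/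

theorem IsOfFinOrder.inv_mul_mul {x : G} (h : IsOfFinOrder x) (g : G) :
    IsOfFinOrder (g⁻¹ * x * g) := by
  simpa using (MulAut.conj g⁻¹).toMonoidHom.isOfFinOrder h

namespace IsAmalgam

variable {N : Subgroup G} {B : ι → Subgroup G}

/-- If the first and last factors differ, nothing cancels in `g * g * ⋯ * g`, so each positive power
has a nonempty reduced expression and is not `1`. -/
theorem head_eq_last (hA : IsAmalgam N B) {l : List ι} {g : G} (h : Alternating N B l g) (hg : IsOfFinOrder g)
    (hl : l ≠ []) : ∃ i, l.head? = some i ∧ l.getLast? = some i := by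
  by_contra hne
  obtain ⟨k, hk, hgk⟩ := isOfFinOrder_iff_pow_eq_one.1 hg
  obtain ⟨l', hl'⟩ := h.exists_pow hA.le (k := k - 1) (fun i hi hi' => hne ⟨i, hi', hi⟩)
  rw [Nat.sub_add_cancel hk, hgk] at hl'
  have := hA.unique hl' (.nil (one_mem N))
  simp_all

/-- An element of finite order outside `N` is conjugate, without cancellation, to an element of a
factor. -/
theorem exists_conj_mem (hA : IsAmalgam N B) : ∀ (l : List ι) {y : G}, Alternating N B l y →
    IsOfFinOrder y → l ≠ [] →
    ∃ (w b : G) (i : ι) (m : List ι), y = w * b * w⁻¹ ∧ b ∈ B i ∧ b ∉ N ∧ Alternating N B m w ∧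
      i ∉ m.getLast? ∧ l = m ++ [i] ++ m.reverse
  | [], _, _, _, h0 => absurd rfl h0
  | [i], y, h, _, _ => by
    obtain ⟨x, hx, hxN, -, g', hg', rfl⟩ := h.exists_of_cons
    refine ⟨1, x * g', i, [], by simp, mul_mem hx (hA.le i hg'.mem_of_nil), ?_, .nil (one_mem N),
      by simp, by simp⟩
    rwa [Subgroup.mul_mem_cancel_right _ hg'.mem_of_nil]
  | i :: j :: l, y, h, hy, _ => by
    obtain ⟨x, hx, hxN, hij, g', hg', rfl⟩ := h.exists_of_cons
    obtain ⟨i', h1, h2⟩ := hA.head_eq_last h hy (by simp)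
    obtain rfl : i = i' := by simpa using h1
    obtain ⟨l₁, hl₁⟩ : ∃ l₁, j :: l = l₁ ++ [i] := by
      rw [List.getLast?_cons_cons, List.getLast?_eq_some_iff] at h2
      exact h2
    rw [hl₁] at hg' hij
    obtain ⟨x', hx', hxN', hil, g, hg, rfl⟩ := hg'.exists_of_concat hA.le
    have hl₁0 : l₁ ≠ [] := by
      rintro rfl
      simp at hij
    have hil₁ : i ∉ l₁.head? := by
      cases l₁ with
      | nil => simp
      | cons => simpa using hij
    have hz : g * (x' * x) = x⁻¹ * (x * (g * x')) * x := by group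
    have hzf : IsOfFinOrder (g * (x' * x)) := by
      rw [hz]
      exact hy.inv_mul_mul x
    -- Cyclic reduction: `y` is conjugate to `g * (x' * x)`. If `x' * x` falls into `N`, the result
    -- is a shorter word of finite order and the recursion applies.
    by_cases hN : x' * x ∈ N
    · have hlen : l₁.length < (i :: j :: l).length := by
        rw [List.length_cons, hl₁]; simp
      obtain ⟨w, b, k, m, he, hb, hbN, hw, hk, hl⟩ :=
        exists_conj_mem hA l₁ (hg.mul_right hA.le hN) hzf hl₁0
      refine ⟨x * w, b, k, i :: m, ?_, hb, hbN, .cons hx hxN ?_ hw, ?_, ?_⟩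
      · have : x * (g * x') = x * (g * (x' * x)) * x⁻¹ := by group
        rw [this, he]; group
      · cases m with
        | nil => simp
        | cons => simpa [hl] using hil₁
      · cases m with
        | nil => simpa [hl, eq_comm] using hil₁
        | cons => simpa [List.getLast?_cons_cons] using hk
      · rw [hl₁, hl]; simp
    -- Otherwise `g * (x' * x)` is reduced and ends in factor `i` but begins in another one, which
    -- its finite order forbids.
    · exfalso
      have h3 := hg.append hA.le (Alternating.single (B := B) (mul_mem hx' hx) hN) (by
        intro k hk; simp only [List.head?_cons, Option.mem_def, Option.some.injEq]
        rintro rfl; exact hil hk)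
      obtain ⟨k, h4, h5⟩ := hA.head_eq_last h3 hzf (by simp)
      simp only [List.getLast?_append, List.getLast?_singleton, Option.some_or,
        Option.some.injEq] at h5
      subst h5
      apply hil₁
      cases l₁ with
      | nil => simp at hl₁0
      | cons => simpa using h4
  termination_by l => l.length
  decreasing_by exact hlen

theorem alternating_conj (hA : IsAmalgam N B) {i : ι} {l m : List ι} {t w : G}
    (hw : Alternating N B m w) (ht : Alternating N B l t) (hi : i ∉ m.getLast?)
    (h1 : l.head? = some i) (h2 : l.getLast? = some i) :
    Alternating N B (m ++ l ++ m.reverse) (w * t * w⁻¹) := by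
  refine (hw.append hA.le ht ?_).append hA.le (hw.inv hA.le) ?_
  · rintro k hk hk'
    rw [h1] at hk'
    obtain rfl : i = k := by simpa using hk'
    exact hi hk
  · rintro k hk hk'
    obtain rfl : i = k := by simpa [List.getLast?_append, h2] using hk
    exact hi (by simpa using hk')

/-- If `w b w⁻¹` is the reduced form of an element outside `N`, and its product with `x` has finite
order, then `w⁻¹ x w` lies in `N` or `w (w⁻¹ x w) w⁻¹` is reduced as well. -/
theorem conj_mem_or (hA : IsAmalgam N B) {i : ι} {m : List ι} {w b x : G}
    (hb : b ∈ B i) (hbN : b ∉ N) (hw : Alternating N B m w) (hi : i ∉ m.getLast?)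
    (hx : IsOfFinOrder x) (hyx : IsOfFinOrder (w * b * w⁻¹ * x)) :
    w⁻¹ * x * w ∈ N ∨ ∃ l, l.head? = some i ∧ Alternating N B l (w⁻¹ * x * w) ∧
      Alternating N B (m ++ l ++ m.reverse) x := by
  obtain ⟨l, hl⟩ := hA.exists_alternating (w⁻¹ * x * w)
  rcases eq_or_ne l [] with rfl | hl0
  · exact .inl hl.mem_of_nil
  right
  have ht : IsOfFinOrder (w⁻¹ * x * w) := by
    exact hx.inv_mul_mul w
  obtain ⟨j, h1, h2⟩ := hA.head_eq_last hl ht hl0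
  have hbt : IsOfFinOrder (b * (w⁻¹ * x * w)) := by
    have : b * (w⁻¹ * x * w) = w⁻¹ * (w * b * w⁻¹ * x) * w := by group
    rw [this]
    exact hyx.inv_mul_mul w
  -- For `i ≠ j` the product `b * (w⁻¹ * x * w)` would be reduced with different end factors,
  -- although it has finite order.
  obtain rfl : i = j := by
    by_contra hij
    have h3 := (Alternating.single (B := B) hb hbN).append hA.le hl (by simpa [h1] using Ne.symm hij)
    obtain ⟨k, h4, h5⟩ := hA.head_eq_last h3 hbt (by simp)
    simp only [List.cons_append, List.head?_cons, Option.some.injEq, List.nil_append] at h4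
    subst h4
    rw [List.getLast?_append, h2] at h5
    simp at h5
    exact hij h5.symm
  refine ⟨l, h1, hl, ?_⟩
  have : x = w * (w⁻¹ * x * w) * w⁻¹ := by group
  rw [this]
  exact hA.alternating_conj hw hl hi h1 h2

/-- A torsion subgroup of an amalgam over a finite subgroup is conjugate to a subgroup of one of
the factors. -/
theorem exists_conj_le [Nonempty ι] (hA : IsAmalgam N B) [Finite N] (Q : Subgroup G)
    (hQ : ∀ x ∈ Q, IsOfFinOrder x) : ∃ (g : G) (i : ι), ∀ x ∈ Q, g * x * g⁻¹ ∈ B i := by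
  choose τ hτ using hA.exists_alternating
  -- If lengths on `Q` are bounded, an element of maximal length supplies both the conjugator and
  -- the factor. If not, a single long element conjugates more than `|N|` elements into `N`.
  by_cases hbdd : BddAbove ((fun x => (τ x).length) '' (Q : Set G))
  · obtain ⟨_, ⟨y, hy, rfl⟩, hmax⟩ : ∃ k ∈ (fun x => (τ x).length) '' (Q : Set G),
        ∀ k' ∈ (fun x => (τ x).length) '' (Q : Set G), k' ≤ k :=
      ⟨_, Nat.sSup_mem ⟨_, 1, one_mem Q, rfl⟩ hbdd, fun k' hk' => le_csSup hbdd hk'⟩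
    rcases eq_or_ne (τ y) [] with h0 | h0
    · obtain ⟨i⟩ := ‹Nonempty ι›
      refine ⟨1, i, fun x hx => ?_⟩
      have h1 := hmax _ ⟨x, hx, rfl⟩
      simp only [h0, List.length_nil, Nat.le_zero, List.length_eq_zero_iff] at h1
      have h2 := hτ x
      rw [h1] at h2
      simpa using hA.le i h2.mem_of_nil
    · obtain ⟨w, b, i, m, he, hb, hbN, hw, hi, hl⟩ := hA.exists_conj_mem _ (hτ y) (hQ y hy) h0
      refine ⟨w⁻¹, i, fun x hx => ?_⟩
      rw [inv_inv]
      rcases hA.conj_mem_or hb hbN hw hi (hQ x hx) (he ▸ hQ _ (mul_mem hy hx)) with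
        h | ⟨l, h1, h2, h3⟩
      · exact hA.le i h
      · have h4 := hmax _ ⟨x, hx, rfl⟩
        simp only [hA.unique (hτ x) h3, hl, List.length_append, List.length_reverse,
          List.length_singleton] at h4
        obtain ⟨l', rfl⟩ : ∃ l', l = i :: l' := by
          cases l with
          | nil => simp at h1
          | cons => simp at h1; exact ⟨_, by rw [h1]⟩
        -- The lengths of `y` and `x` are `2|m| + 1` and `2|m| + |l|`, so maximality of `y` leaves
        -- `|l| = 1`.
        obtain rfl : l' = [] := by
          rw [← List.length_eq_zero_iff]; rw [List.length_cons] at h4; omega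
        exact h2.mem_of_single hA.le
  · exfalso
    have hinf : (Q : Set G).Infinite := fun hfin => hbdd (hfin.image _).bddAbove
    obtain ⟨X, hXQ, hX⟩ := hinf.exists_subset_card_eq (Nat.card N + 1)
    rw [not_bddAbove_iff] at hbdd
    -- As `y` is longer than every element of `X`, no `x ∈ X` can have length `2|m| + |l|` with `|l|
    -- ≥ 1`; only the alternative in `N` remains.
    obtain ⟨_, ⟨y, hy, rfl⟩, hlt⟩ := hbdd (X.sup fun x => (τ x).length)
    have h0 : τ y ≠ [] := by
      intro h; simp [h] at hlt
    obtain ⟨w, b, i, m, he, hb, hbN, hw, hi, hl⟩ := hA.exists_conj_mem _ (hτ y) (hQ y hy) h0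
    have hN : ∀ x ∈ X, w⁻¹ * x * w ∈ N := by
      intro x hxX
      have hx := hXQ hxX
      rcases hA.conj_mem_or hb hbN hw hi (hQ x hx) (he ▸ hQ _ (mul_mem hy hx)) with
        h | ⟨l, h1, h2, h3⟩
      · exact h
      · have h4 := (Finset.le_sup (f := fun x => (τ x).length) hxX).trans_lt hlt
        simp only [hA.unique (hτ x) h3, hl, List.length_append, List.length_reverse,
          List.length_singleton] at h4
        have : 0 < l.length := List.length_pos_iff.2 (by rintro rfl; simp at h1)
        omega
    have hcard : Nat.card X ≤ Nat.card N :=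
      Nat.card_le_card_of_injective (fun x : X => (⟨w⁻¹ * x.1 * w, hN x.1 x.2⟩ : N)) (by
        intro a b hab
        simpa using hab)
    simp [hX] at hcard

end IsAmalgam
end Alternating

/-! ### Pushouts of groups along injective maps have unique reduced expressions. -/

section Pushout

open Monoid Monoid.PushoutI

variable {ι : Type*} {G : ι → Type*} {H : Type*} [∀ i, Group (G i)] [Group H] {φ : ∀ i, H →* G i}

theorem of_mem_base_range_iff (hφ : ∀ i, Function.Injective (φ i)) {i : ι} {x : G i} :
    of (φ := φ) i x ∈ (base φ).range ↔ x ∈ (φ i).range := by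
  constructor
  · rintro ⟨n, hn⟩
    rw [← of_apply_eq_base φ i] at hn
    exact ⟨n, of_injective hφ i hn⟩
  · rintro ⟨n, rfl⟩
    exact ⟨n, (of_apply_eq_base φ i n).symm⟩

/-- Prefixing a syllable to a normal word alters coset representatives and the base element but not
the indices. Uniqueness of normal words thus becomes uniqueness of the sequence of factors. -/
theorem Alternating.exists_normalWord (hφ : ∀ i, Function.Injective (φ i))
    (d : NormalWord.Transversal φ) {l : List ι} {g : PushoutI φ}
    (h : Alternating (base φ).range (fun i => (of (φ := φ) i).range) l g) :
    ∃ w : NormalWord d, w.prod = g ∧ w.toList.map Sigma.fst = l := by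
  classical
  induction h with
  | nil hn =>
    obtain ⟨n, rfl⟩ := hn
    exact ⟨n • NormalWord.empty, by simp, rfl⟩
  | @cons i l x g hx hxN hl hg ih =>
    obtain ⟨x, rfl⟩ := hx
    obtain ⟨w, rfl, rfl⟩ := ih
    rw [of_mem_base_range_iff hφ] at hxN
    have hw : w.fstIdx ≠ some i := by
      rwa [CoprodI.Word.fstIdx, ← List.head?_map]
    exact ⟨NormalWord.cons x w hw hxN, by simp, by simp⟩

theorem isAmalgam_pushoutI (hφ : ∀ i, Function.Injective (φ i)) :
    IsAmalgam (base φ).range (fun i => (of (φ := φ) i).range) where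
  le i := by
    rintro _ ⟨n, rfl⟩
    exact ⟨φ i n, of_apply_eq_base φ i n⟩
  exists_alternating g := by
    classical
    obtain ⟨d⟩ := NormalWord.transversal_nonempty φ hφ
    have hle : ∀ i, (base φ).range ≤ (of (φ := φ) i).range := by
      rintro i _ ⟨n, rfl⟩
      exact ⟨φ i n, of_apply_eq_base φ i n⟩
    suffices h : ∀ w : NormalWord d, Alternating (base φ).range
        (fun i => (of (φ := φ) i).range) (w.toList.map Sigma.fst) w.prod by
      exact ⟨_, by simpa [NormalWord.equiv] using h (NormalWord.equiv g)⟩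
    intro w
    induction w using NormalWord.consRecOn with
    | empty => 
      rw [NormalWord.prod_empty]
      exact .nil (one_mem _)
    | cons i x w hmw _ hgr _ ih =>
      simp only [NormalWord.prod_cons, NormalWord.cons_toList, List.map_cons]
      refine .cons ⟨x, rfl⟩ (by rwa [of_mem_base_range_iff hφ]) ?_ ih
      rwa [List.head?_map]
    | base h w _ ih =>
      rw [NormalWord.prod_smul]
      exact ih.mul_left hle ⟨h, rfl⟩
  unique h h' := by
    obtain ⟨d⟩ := NormalWord.transversal_nonempty φ hφ
    obtain ⟨w, hw, rfl⟩ := h.exists_normalWord hφ d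
    obtain ⟨w', hw', rfl⟩ := h'.exists_normalWord hφ d
    rw [NormalWord.prod_injective (hw.trans hw'.symm)]

end Pushout


/-! ### Fusion and Sylow subgroups in an amalgam. -/

section Amalgam

theorem IsAmalgam.mem_of_mem_of_mem {G ι : Type*} [Group G] {N : Subgroup G} {B : ι → Subgroup G}
    (hA : IsAmalgam N B) {i j : ι} (hij : i ≠ j) {x : G} (hi : x ∈ B i) (hj : x ∈ B j) :
    x ∈ N := by
  by_contra hx
  have := hA.unique (Alternating.single hi hx) (Alternating.single hj hx)
  simp at this
  exact hij this

theorem IsAmalgam.length_le_one {G ι : Type*} [Group G] {N : Subgroup G} {B : ι → Subgroup G}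
    (hA : IsAmalgam N B) {i : ι} {l : List ι} {x : G} (hi : x ∈ B i)
    (hl : Alternating N B l x) : l.length ≤ 1 := by
  by_cases hx : x ∈ N
  · simp [hA.unique hl (.nil hx)]
  · simp [hA.unique hl (.single hi hx)]

theorem exists_lift_of_mem_map {S H G : Type*} [Group S] [Group H] [Group G] {ι : S →* G}
    (hι : Function.Injective ι) (f : H →* G) (Q : Subgroup S) (hf : ∀ x, f x ∈ Q.map ι) :
    ∃ φ : H →* Q, ∀ x, ι (φ x) = f x := by
  refine ⟨((Q.equivMapOfInjective ι hι).symm.toMonoidHom).comp (f.codRestrict (Q.map ι) hf),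
    fun x => ?_⟩
  rw [← Subgroup.coe_equivMapOfInjective_apply Q ι hι]
  simp

namespace FusionSystem

variable {S : Type u} [Group S] (F : FusionSystem S)

theorem inclusion_mem {P Q : Subgroup S} (h : P ≤ Q) : Subgroup.inclusion h ∈ F.Hom P Q := by
  convert F.conj_mem P Q 1 (by simpa using fun x hx => h hx) using 1
  ext x
  simp [conjHom]

/-- By the factorization axiom a morphism is an isomorphism onto its image followed by an inclusion,
so membership depends only on the underlying map to `S`. -/
theorem hom_congr {P Q Q' : Subgroup S} {φ : P →* Q} {φ' : P →* Q'}
    (h : ∀ x, (φ x : S) = φ' x) (hφ : φ ∈ F.Hom P Q) : φ' ∈ F.Hom P Q' := by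
  obtain ⟨R, hRQ, e, he, -, rfl⟩ := F.factor hφ
  have hR : R ≤ Q' := by
    intro r hr
    obtain ⟨x, hx⟩ := e.surjective ⟨r, hr⟩
    have h1 : (e x : S) = φ' x := h x
    rw [hx] at h1
    exact (show r = φ' x from h1) ▸ (φ' x).2
  have : φ' = (Subgroup.inclusion hR).comp e.toMonoidHom := by
    ext x
    exact (h x).symm
  rw [this]
  exact F.comp_mem he (F.inclusion_mem hR)

/-- If conjugation by elements of the factors of an amalgam induces only morphisms of `F`, then so
does conjugation by elements of the amalgam. -/
theorem mem_hom_of_isAmalgam {G I : Type*} [Group G] {N : Subgroup G} {B : I → Subgroup G}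
    (hA : IsAmalgam N B) {ι : S →* G} (hι : Function.Injective ι) (hN : N ≤ ι.range) {i₀ : I}
    (hi₀ : ι.range ≤ B i₀)
    (hF : ∀ i, ∀ a ∈ B i, ∀ (P Q : Subgroup S) (φ : P →* Q), (∀ x : P, ι x ∈ B i) →
      (∀ x : P, ι (φ x) = a * ι x * a⁻¹) → φ ∈ F.Hom P Q)
    {l : List I} : ∀ {g : G} {P Q : Subgroup S} {φ : P →* Q}, Alternating N B l g →
      (∀ x : P, ι (φ x) = g * ι x * g⁻¹) → φ ∈ F.Hom P Q := by
  induction l using List.reverseRecOn with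
  | nil =>
    intro g P Q φ hg hφ
    exact hF i₀ g (hA.le i₀ hg.mem_of_nil) P Q φ (fun x => hi₀ ⟨x, rfl⟩) hφ
  | append_singleton l i ih =>
    intro g P Q φ hg hφ
    have hP : ∀ x : P, ι x ∈ B i := by
      intro x
      rcases eq_or_ne i i₀ with rfl | hi
      · exact hi₀ ⟨x, rfl⟩
      by_contra hx
      -- Otherwise `ι x` is a syllable of factor `i₀ ≠ i`, and `g * ι x * g⁻¹` is reduced of length
      -- at least 3. But it lies in `B i₀`, where lengths are at most 1.
      have h1 := Alternating.single (B := B) (i := i₀) (hi₀ ⟨(x : S), rfl⟩)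
        (fun h => hx (hA.le i h))
      have h2 := (hg.append hA.le h1 (by simpa [eq_comm] using hi)).append hA.le (hg.inv hA.le)
        (by simpa [eq_comm] using hi)
      rw [← hφ] at h2
      have := hA.length_le_one (hi₀ ⟨_, rfl⟩) h2
      simp at this
      omega
    rcases eq_or_ne l [] with rfl | hl
    · exact hF i g (hg.mem_of_single hA.le) P Q φ hP hφ
    obtain ⟨a, ha, haN, hil, g', hg', rfl⟩ := hg.exists_of_concat hA.le
    have hN' : ∀ x : P, a * ι x * a⁻¹ ∈ N := by
      intro x
      by_contra hx
      -- The same contradiction: as `l` is nonempty and does not end in `i`, conjugating this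
      -- syllable by `g'` gives length at least 3.
      have h1 := Alternating.single (B := B) (mul_mem (mul_mem ha (hP x)) (inv_mem ha)) hx
      have h2 := (hg'.append hA.le h1 (by rintro k hk hk'; simp at hk'; subst hk'; exact hil hk)
        ).append hA.le (hg'.inv hA.le)
          (by rintro k hk hk'; simp at hk hk'; subst hk; exact hil hk')
      have h3 : g' * (a * ι x * a⁻¹) * g'⁻¹ = ι (φ x) := by rw [hφ]; group
      rw [h3] at h2
      have := hA.length_le_one (hi₀ ⟨_, rfl⟩) h2
      have := List.length_pos_iff.2 hl
      simp at *
      omega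
    obtain ⟨φ₁, hφ₁⟩ := exists_lift_of_mem_map hι
      ((MulAut.conj a).toMonoidHom.comp (ι.comp P.subtype)) ⊤
      (fun x => by
        obtain ⟨s, hs⟩ := hN (hN' x)
        exact ⟨s, trivial, by simpa using hs⟩)
    replace hφ₁ : ∀ x : P, ι (φ₁ x) = a * ι x * a⁻¹ := by simpa using hφ₁
    -- Because `N ≤ ι.range`, the intermediate conjugate `a P a⁻¹` comes from a subgroup `R` of `S`.
    -- The last syllable `a` acts first, and induction handles `g'`.
    let R : Subgroup S := φ₁.range.map (Subgroup.subtype ⊤)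
    obtain ⟨φ₂, hφ₂⟩ := exists_lift_of_mem_map hι
      ((MulAut.conj g').toMonoidHom.comp (ι.comp R.subtype)) Q (by
        rintro ⟨_, _, ⟨x, rfl⟩, rfl⟩
        refine ⟨φ x, (φ x).2, ?_⟩
        rw [hφ]
        simp [hφ₁, mul_assoc])
    replace hφ₂ : ∀ x : R, ι (φ₂ x) = g' * ι x * g'⁻¹ := by simpa using hφ₂
    let ψ : P →* R := ((Subgroup.subtype ⊤).comp φ₁).codRestrict R (fun x => ⟨_, ⟨x, rfl⟩, rfl⟩)
    have hψ : ψ ∈ F.Hom P R := hF i a ha P R ψ hP hφ₁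
    have : φ = φ₂.comp ψ := by
      ext x
      apply hι
      rw [hφ, MonoidHom.comp_apply, hφ₂]
      have : ι (ψ x) = a * ι x * a⁻¹ := hφ₁ x
      rw [this]
      group
    rw [this]
    exact F.comp_mem hψ (ih hg' hφ₂)

end FusionSystem

theorem IsSylowSubgroup.exists_conj_le_map {p : ℕ} {A G : Type u} [Group A] [Group G]
    {T : Subgroup A} (hT : IsSylowSubgroup p T) {f : A →* G} (hf : Function.Injective f)
    {Q : Subgroup G} (hQ : IsPGroup p Q) (hQf : Q ≤ f.range) :
    ∃ g : G, ∀ x ∈ Q, g * x * g⁻¹ ∈ T.map f := by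
  obtain ⟨a, ha⟩ := hT.2.2 (Q.comap f) (hQ.comap_of_injective f hf)
  refine ⟨f a, fun x hx => ?_⟩
  obtain ⟨y, rfl⟩ := hQf hx
  exact ⟨a * y * a⁻¹, ha y hx, by simp⟩

theorem Sylow.isSylowSubgroup {p : ℕ} [Fact p.Prime] {G : Type u} [Group G] [Finite G]
    (T : Sylow p G) : IsSylowSubgroup p (T : Subgroup G) := by
  refine ⟨inferInstance, T.isPGroup', fun Q hQ => ?_⟩
  obtain ⟨R, hR⟩ := hQ.exists_le_sylow
  obtain ⟨g, hg⟩ := MulAction.exists_smul_eq G R T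
  refine ⟨g, fun x hx => ?_⟩
  rw [← hg]
  exact ⟨x, hR hx, rfl⟩

theorem IsAmalgam.isSylowSubgroup {p : ℕ} [Fact p.Prime] {G : Type u} {I : Type*} [Nonempty I]
    [Group G] {N : Subgroup G} {B : I → Subgroup G} (hA : IsAmalgam N B) [Finite N]
    {T : Subgroup G} (hfin : Finite T) (hT : IsPGroup p T)
    (h : ∀ i (Q : Subgroup G), IsPGroup p Q → Q ≤ B i → ∃ g : G, ∀ x ∈ Q, g * x * g⁻¹ ∈ T) :
    IsSylowSubgroup p T := by
  refine ⟨hfin, hT, fun Q hQ => ?_⟩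
  obtain ⟨g, i, hg⟩ := hA.exists_conj_le Q (fun x hx => by
    obtain ⟨k, hk⟩ := hQ ⟨x, hx⟩
    exact isOfFinOrder_iff_pow_eq_one.2 ⟨p ^ k, pow_pos (Fact.out : p.Prime).pos k,
      by simpa using congrArg Subtype.val hk⟩)
  obtain ⟨a, ha⟩ := h i (Q.map (MulAut.conj g).toMonoidHom) (hQ.map _) (by
    rintro _ ⟨x, hx, rfl⟩
    exact hg x hx)
  refine ⟨a * g, fun x hx => ?_⟩
  have : a * g * x * (a * g)⁻¹ = a * (g * x * g⁻¹) * a⁻¹ := by group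
  rw [this]
  exact ha _ ⟨x, hx, rfl⟩

end Amalgam


/-! ### Iterated amalgams under `S`. -/

section GroupUnder

variable {S : Type u} [Group S]

theorem amalgMap_injective {N A K : Type u} [Group N] [Group A] [Group K] {α : N →* A}
    {θ : N →* K} (hα : Function.Injective α) (hθ : Function.Injective θ) :
    ∀ b, Function.Injective (amalgMap α θ b)
  | false => hα
  | true => hθ

namespace GroupUnder

variable (A : GroupUnder S) {N : Subgroup S} {K : Type u} [Group K] (θ : N →* K)

/-- The canonical map of the first factor to the amalgam. -/
def amalgamInl : A.carrier →* (A.amalgam θ).carrier :=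
  Monoid.PushoutI.of (φ := amalgMap (A.ι.comp N.subtype) θ) false

/-- The canonical map of the second factor to the amalgam. -/
def amalgamInr : K →* (A.amalgam θ).carrier :=
  Monoid.PushoutI.of (φ := amalgMap (A.ι.comp N.subtype) θ) true

theorem amalgam_ι_apply (s : S) : (A.amalgam θ).ι s = A.amalgamInl θ (A.ι s) := rfl

theorem amalgamInr_apply (n : N) : A.amalgamInr θ (θ n) = (A.amalgam θ).ι n :=
  (Monoid.PushoutI.of_apply_eq_base (amalgMap (A.ι.comp N.subtype) θ) true n).trans
    (Monoid.PushoutI.of_apply_eq_base (amalgMap (A.ι.comp N.subtype) θ) false n).symm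

/-- The two factors as subgroups of the amalgam. -/
def amalgamFactor (b : Bool) : Subgroup (A.amalgam θ).carrier :=
  bif b then (A.amalgamInr θ).range else (A.amalgamInl θ).range

variable {A θ}

theorem amalgamInl_injective (hA : Function.Injective A.ι) (hθ : Function.Injective θ) :
    Function.Injective (A.amalgamInl θ) :=
  Monoid.PushoutI.of_injective
    (amalgMap_injective (α := A.ι.comp N.subtype) (hA.comp N.subtype_injective) hθ) false

theorem amalgamInr_injective (hA : Function.Injective A.ι) (hθ : Function.Injective θ) :
    Function.Injective (A.amalgamInr θ) :=
  Monoid.PushoutI.of_injective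
    (amalgMap_injective (α := A.ι.comp N.subtype) (hA.comp N.subtype_injective) hθ) true

theorem amalgam_ι_injective (hA : Function.Injective A.ι) (hθ : Function.Injective θ) :
    Function.Injective (A.amalgam θ).ι :=
  (amalgamInl_injective hA hθ).comp hA

theorem isAmalgam (hA : Function.Injective A.ι) (hθ : Function.Injective θ) :
    IsAmalgam (N.map (A.amalgam θ).ι) (A.amalgamFactor θ) := by
  have h := isAmalgam_pushoutI (amalgMap_injective (α := A.ι.comp N.subtype) (hA.comp N.subtype_injective) hθ)
  have h1 : N.map (A.amalgam θ).ι =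
      (Monoid.PushoutI.base (amalgMap (A.ι.comp N.subtype) θ)).range := by
    ext x
    constructor
    · rintro ⟨n, hn, rfl⟩
      exact ⟨⟨n, hn⟩, (Monoid.PushoutI.of_apply_eq_base
        (amalgMap (A.ι.comp N.subtype) θ) false ⟨n, hn⟩).symm⟩
    · rintro ⟨n, rfl⟩
      exact ⟨n, n.2, Monoid.PushoutI.of_apply_eq_base
        (amalgMap (A.ι.comp N.subtype) θ) false n⟩
  have h2 : A.amalgamFactor θ = fun b =>
      (Monoid.PushoutI.of (φ := amalgMap (A.ι.comp N.subtype) θ) b).range := by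
    ext b : 1
    cases b <;> rfl
  rw [h1, h2]
  exact h

/-- In the factor `K` only elements of `N` come from `S`, so conjugation inside that factor gives a
morphism of `F_N(K)` once its target is replaced by `N`. -/
theorem ofGroup_amalgam_le {F : FusionSystem S} (hA : Function.Injective A.ι)
    (hθ : Function.Injective θ) (hι : Function.Injective (A.amalgam θ).ι)
    (hAF : (FusionSystem.ofGroup A.ι hA).Le F)
    (hKF : ∀ Q R, subgroupFusion θ Q R ⊆ F.Hom Q R) :
    (FusionSystem.ofGroup (A.amalgam θ).ι hι).Le F := by
  have hT := isAmalgam hA hθ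
  have hle : (A.amalgam θ).ι.range ≤ A.amalgamFactor θ false := by
    rintro _ ⟨s, rfl⟩
    exact ⟨A.ι s, rfl⟩
  rintro P Q φ ⟨g, hg⟩
  obtain ⟨l, hl⟩ := hT.exists_alternating g
  refine F.mem_hom_of_isAmalgam hT hι ?_ hle ?_ hl hg
  · rintro _ ⟨n, -, rfl⟩
    exact ⟨n, rfl⟩
  clear hg φ P Q
  rintro (_ | _) _ ⟨a, rfl⟩ P Q φ hP hφ
  · refine hAF P Q ⟨a, fun x => amalgamInl_injective hA hθ ?_⟩
    rw [← amalgam_ι_apply, hφ]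
    simp [amalgam_ι_apply]
  · have hN : ∀ s : S, (A.amalgam θ).ι s ∈ A.amalgamFactor θ true → s ∈ N := by
      intro s hs
      obtain ⟨n, hn, hns⟩ := hT.mem_of_mem_of_mem (by simp) (hle ⟨s, rfl⟩) hs
      rwa [← hι hns]
    have hPN : P ≤ N := fun x hx => hN x (hP ⟨x, hx⟩)
    let φ' : P →* N := (Q.subtype.comp φ).codRestrict N (fun x => hN _ (by
      change (A.amalgam θ).ι (φ x) ∈ _
      rw [hφ]
      exact mul_mem (mul_mem ⟨a, rfl⟩ (hP x)) (inv_mem ⟨a, rfl⟩)))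
    have hφ' : φ' ∈ F.Hom P N := by
      refine hKF P N ⟨hPN, le_rfl, a, fun x => amalgamInr_injective hA hθ ?_⟩
      rw [amalgamInr_apply, map_mul, map_mul, map_inv, amalgamInr_apply]
      exact hφ x
    exact F.hom_congr (φ := φ') (φ' := φ) (fun _ => rfl) hφ'

theorem isSylowSubgroup_amalgam {p : ℕ} [Fact p.Prime] [Finite S] (hS : IsPGroup p S)
    (hA : Function.Injective A.ι) (hθ : Function.Injective θ)
    (hpA : IsSylowSubgroup p A.ι.range) (hpK : IsSylowSubgroup p θ.range) :
    IsSylowSubgroup p (A.amalgam θ).ι.range := by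
  have hfin : Finite (A.amalgam θ).ι.range :=
    Finite.of_surjective _ (A.amalgam θ).ι.rangeRestrict_surjective
  have : Finite (N.map (A.amalgam θ).ι) :=
    (Set.toFinite ((A.amalgam θ).ι '' (N : Set S))).to_subtype
  refine (isAmalgam hA hθ).isSylowSubgroup hfin
    (hS.of_surjective _ (A.amalgam θ).ι.rangeRestrict_surjective) ?_
  rintro (_ | _) Q hQ hQB
  · obtain ⟨g, hg⟩ := hpA.exists_conj_le_map (amalgamInl_injective hA hθ) hQ hQB
    refine ⟨g, fun x hx => ?_⟩
    obtain ⟨_, ⟨s, rfl⟩, h⟩ := hg x hx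
    exact ⟨s, h⟩
  · obtain ⟨g, hg⟩ := hpK.exists_conj_le_map (amalgamInr_injective hA hθ) hQ hQB
    refine ⟨g, fun x hx => ?_⟩
    obtain ⟨_, ⟨s, rfl⟩, h⟩ := hg x hx
    exact ⟨s, by rw [← h, amalgamInr_apply]⟩

theorem iteratedAmalgam_ι_injective (A : GroupUnder S) (hA : Function.Injective A.ι) :
    ∀ {r : ℕ} {N : Fin r → Subgroup S} {K : Fin r → Type u} [∀ k, Group (K k)]
      (θ : ∀ k, N k →* K k), (∀ k, Function.Injective (θ k)) →
      Function.Injective (A.iteratedAmalgam θ).ι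
  | 0, _, _, _, _, _ => hA
  | _ + 1, _, _, _, _, h =>
    amalgam_ι_injective (A.iteratedAmalgam_ι_injective hA _ fun _ => h _) (h _)

theorem ofGroup_iteratedAmalgam_le {F : FusionSystem S} (A : GroupUnder S)
    (hA : Function.Injective A.ι) (hAF : (FusionSystem.ofGroup A.ι hA).Le F) :
    ∀ {r : ℕ} {N : Fin r → Subgroup S} {K : Fin r → Type u} [∀ k, Group (K k)]
      (θ : ∀ k, N k →* K k), (∀ k, Function.Injective (θ k)) →
      (∀ k Q R, subgroupFusion (θ k) Q R ⊆ F.Hom Q R) →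
      ∀ hι : Function.Injective (A.iteratedAmalgam θ).ι,
      (FusionSystem.ofGroup (A.iteratedAmalgam θ).ι hι).Le F
  | 0, _, _, _, _, _, _, _ => hAF
  | _ + 1, _, _, _, _, h, hF, hι =>
    ofGroup_amalgam_le (A.iteratedAmalgam_ι_injective hA _ fun _ => h _) (h _) hι
      (A.ofGroup_iteratedAmalgam_le hA hAF _ (fun _ => h _) (fun _ => hF _) _) (hF _)

theorem isSylowSubgroup_iteratedAmalgam {p : ℕ} [Fact p.Prime] [Finite S] (hS : IsPGroup p S)
    (A : GroupUnder S) (hA : Function.Injective A.ι) (hpA : IsSylowSubgroup p A.ι.range) :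
    ∀ {r : ℕ} {N : Fin r → Subgroup S} {K : Fin r → Type u} [∀ k, Group (K k)]
      (θ : ∀ k, N k →* K k), (∀ k, Function.Injective (θ k)) →
      (∀ k, IsSylowSubgroup p (θ k).range) →
      IsSylowSubgroup p (A.iteratedAmalgam θ).ι.range
  | 0, _, _, _, _, _, _ => hpA
  | _ + 1, _, _, _, _, h, hp =>
    isSylowSubgroup_amalgam hS (A.iteratedAmalgam_ι_injective hA _ fun _ => h _) (h _)
      (A.isSylowSubgroup_iteratedAmalgam hS hA hpA _ (fun _ => h _) (fun _ => hp _)) (hp _)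

theorem exists_iteratedAmalgamInl (A : GroupUnder S) :
    ∀ {r : ℕ} {N : Fin r → Subgroup S} {K : Fin r → Type u} [∀ k, Group (K k)]
      (θ : ∀ k, N k →* K k),
      ∃ f : A.carrier →* (A.iteratedAmalgam θ).carrier,
        ∀ s, f (A.ι s) = (A.iteratedAmalgam θ).ι s
  | 0, _, _, _, _ => ⟨MonoidHom.id _, fun _ => rfl⟩
  | _ + 1, _, _, _, θ => by
    obtain ⟨f, hf⟩ := A.exists_iteratedAmalgamInl (fun k => θ (Fin.castSucc k))
    exact ⟨(amalgamInl _ _).comp f, fun s => congrArg (amalgamInl _ _) (hf s)⟩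

theorem exists_iteratedAmalgamInr (A : GroupUnder S) :
    ∀ {r : ℕ} {N : Fin r → Subgroup S} {K : Fin r → Type u} [∀ k, Group (K k)]
      (θ : ∀ k, N k →* K k) (k : Fin r),
      ∃ f : K k →* (A.iteratedAmalgam θ).carrier,
        ∀ x : N k, f (θ k x) = (A.iteratedAmalgam θ).ι x
  | _ + 1, _, _, _, θ, k => by
    induction k using Fin.lastCases with
    | last => exact ⟨amalgamInr _ _, fun x => amalgamInr_apply _ _ x⟩
    | cast k =>
      obtain ⟨f, hf⟩ := A.exists_iteratedAmalgamInr (fun k => θ (Fin.castSucc k)) k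
      exact ⟨(amalgamInl _ _).comp f, fun s => congrArg (amalgamInl _ _) (hf s)⟩

end GroupUnder
end GroupUnder


/-! ### Strongly embedded subgroups, centric subgroups and extension to normalizers. -/

section Automizers

/-- If `p` divides the order of `H ∩ gHg⁻¹`, take an element of order `p` there. It and its preimage
under conjugation by `g` are `H`-conjugate into `T`, which yields an element outside `H` fusing
nontrivial elements of `T`. -/
theorem isStronglyEmbedded_of_sylow {p : ℕ} [Fact p.Prime] {O : Type u} [Group O] [Finite O]
    (T : Sylow p O) {H : Subgroup O} (hTH : (T : Subgroup O) ≤ H) (hH : H ≠ ⊤)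
    (hT : (T : Subgroup O) ≠ ⊥) (h : ∀ k ∉ H, ∀ y ∈ T, k * y * k⁻¹ ∈ T → y = 1) :
    IsStronglyEmbedded p H := by
  have hconj : ∀ x ∈ H, orderOf x = p → ∃ a ∈ H, a * x * a⁻¹ ∈ T := by
    intro x hx hxp
    obtain ⟨a, ha⟩ := (T.subtype hTH).isSylowSubgroup.2.2 (Subgroup.zpowers ⟨x, hx⟩)
      (IsPGroup.of_card (n := 1) (by rw [Nat.card_zpowers, ← Subgroup.orderOf_coe, hxp, pow_one]))
    exact ⟨a, a.2, ha _ (Subgroup.mem_zpowers _)⟩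
  refine ⟨hH, ?_, fun g hg hp => ?_⟩
  · refine dvd_trans ?_ (Subgroup.card_dvd_of_le hTH)
    have : Nontrivial T := (Subgroup.nontrivial_iff_ne_bot _).2 hT
    obtain ⟨n, hn, hcard⟩ := T.isPGroup'.nontrivial_iff_card.1 this
    rw [hcard]
    exact dvd_pow_self p hn.ne'
  · obtain ⟨⟨x, hxH, z, hz, hzx⟩, hx⟩ := exists_prime_orderOf_dvd_card' p hp
    rw [← Subgroup.orderOf_coe] at hx
    simp only [MulEquiv.toMonoidHom_eq_coe, MonoidHom.coe_coe, MulAut.conj_apply] at hzx hx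
    obtain ⟨a, ha, hax⟩ := hconj x hxH hx
    have hzp : orderOf z = p := by
      rw [← hx, ← hzx]
      exact ((MulAut.conj g).orderOf_eq z).symm
    obtain ⟨b, hb, hbz⟩ := hconj z hz hzp
    have h1 := h (a * g * b⁻¹) (fun hmem => hg (by
      have := mul_mem (mul_mem (inv_mem ha) hmem) hb
      simpa [mul_assoc] using this)) (b * z * b⁻¹) hbz (by
        convert hax using 1
        rw [← hzx]; group)
    have h2 : z = 1 := by simpa using h1
    rw [h2, orderOf_one] at hzp
    exact (Fact.out : p.Prime).one_lt.ne hzp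

/-- When `C_S(R) ≤ R`, the left side is `Z(R)`, and `e` carries it into `Z(R')`. -/
theorem card_centralizer_le {S : Type u} [Group S] [Finite S] {R R' : Subgroup S} (e : R ≃* R')
    (h : Subgroup.centralizer (R : Set S) ≤ R) :
    Nat.card (Subgroup.centralizer (R : Set S)) ≤
      Nat.card (Subgroup.centralizer (R' : Set S) ⊓ R' : Subgroup S) := by
  refine Nat.card_le_card_of_injective (fun x => ⟨e ⟨x, h x.2⟩, ?_, (e _).2⟩) ?_
  · refine Subgroup.mem_centralizer_iff.2 ?_
    intro y hy
    obtain ⟨r, hr⟩ := e.surjective ⟨y, hy⟩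
    obtain rfl : (e r : S) = y := congrArg Subtype.val hr
    have h1 : r * ⟨x, h x.2⟩ = ⟨x, h x.2⟩ * r :=
      Subtype.ext ((Subgroup.mem_centralizer_iff.1 x.2) r r.2)
    have := congrArg (fun z => (e z : S)) h1
    simpa using this
  · intro x y hxy
    have h0 : (e ⟨x, h x.2⟩ : S) = e ⟨y, h y.2⟩ :=
      congrArg (fun z : (Subgroup.centralizer (R' : Set S) ⊓ R' : Subgroup S) => (z : S)) hxy
    have h1 := e.injective (Subtype.ext h0)
    exact Subtype.ext (congrArg (fun z : R => (z : S)) h1)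

namespace FusionSystem

variable {S : Type u} [Group S] {F : FusionSystem S}

theorem symm_mem {P R : Subgroup S} {e : P ≃* R} (he : e.toMonoidHom ∈ F.Hom P R) :
    e.symm.toMonoidHom ∈ F.Hom R P := by
  obtain ⟨R', hR, e', -, he', h⟩ := F.factor he
  obtain rfl : R' = R := by
    refine le_antisymm hR fun r hr => ?_
    have h1 := DFunLike.congr_fun h (e.symm ⟨r, hr⟩)
    have h2 : r = e' (e.symm ⟨r, hr⟩) := by simpa using congrArg Subtype.val h1
    rw [h2]
    exact (e' _).2
  obtain rfl : e = e' := by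
    ext x
    exact congrArg Subtype.val (DFunLike.congr_fun h x)
  exact he'

theorem trans_mem {P Q R : Subgroup S} {e : P ≃* Q} {f : Q ≃* R}
    (he : e.toMonoidHom ∈ F.Hom P Q) (hf : f.toMonoidHom ∈ F.Hom Q R) :
    (e.trans f).toMonoidHom ∈ F.Hom P R :=
  F.comp_mem he hf

theorem mem_aut_iff {P : Subgroup S} {a : MulAut P} :
    a ∈ F.aut P ↔ MulEquiv.toMonoidHom a ∈ F.Hom P P :=
  ⟨fun h => h.1, fun h => ⟨h, symm_mem h⟩⟩

theorem Conj.symm {P Q : Subgroup S} (h : F.Conj P Q) : F.Conj Q P := by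
  obtain ⟨e, he, he'⟩ := h
  exact ⟨e.symm, he', he⟩

theorem Conj.trans {P Q R : Subgroup S} (h : F.Conj P Q) (h' : F.Conj Q R) : F.Conj P R := by
  obtain ⟨e, he, he'⟩ := h
  obtain ⟨f, hf, hf'⟩ := h'
  exact ⟨e.trans f, trans_mem he hf, trans_mem hf' he'⟩

theorem Conj.refl (F : FusionSystem S) (P : Subgroup S) : F.Conj P P :=
  ⟨1, (one_mem (F.aut P)).1, (one_mem (F.aut P)).2⟩

theorem normalizerMonoidHom_mem_aut (F : FusionSystem S) {P : Subgroup S} (g : nrm P) :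
    P.normalizerMonoidHom g ∈ F.aut P := by
  rw [mem_aut_iff]
  convert F.conj_mem P P g fun x hx => (Subgroup.mem_normalizer_iff.1 g.2 x).1 hx using 1
  ext x
  rfl

theorem autS_le_aut (F : FusionSystem S) (P : Subgroup S) : autS P ≤ F.aut P := by
  rintro _ ⟨g, rfl⟩
  exact F.normalizerMonoidHom_mem_aut g

theorem innerAut_le_autS (P : Subgroup S) : innerAut P ≤ autS P := by
  rintro _ ⟨g, rfl⟩
  refine ⟨⟨g, Subgroup.le_normalizer g.2⟩, ?_⟩
  ext x
  rfl

theorem congr_mem_aut {P R : Subgroup S} {e : P ≃* R} (he : e.toMonoidHom ∈ F.Hom P R)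
    {a : MulAut P} (ha : a ∈ F.aut P) : MulAut.congr e a ∈ F.aut R :=
  mem_aut_iff.2 (F.comp_mem (symm_mem he) (F.comp_mem (mem_aut_iff.1 ha) he))

theorem le_extender {P Q : Subgroup S} (φ : P →* Q) : P ≤ extender φ := fun r hr =>
  ⟨Subgroup.le_normalizer hr, φ ⟨r, hr⟩, Subgroup.le_normalizer ⟨⟨r, hr⟩, rfl⟩, fun x => by
    have : P.normalizerMonoidHom ⟨r, Subgroup.le_normalizer hr⟩ x =
      ⟨r, hr⟩ * x * (⟨r, hr⟩ : P)⁻¹ := rfl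
    rw [this]
    simp⟩

theorem mem_of_extends {E : FusionSystem S} {P P' Q : Subgroup S} {φ : P →* Q}
    {ψ : P' →* (⊤ : Subgroup S)} (hψ : ψ ∈ E.Hom P' ⊤) (hP : P ≤ P')
    (h : ∀ (x : S) (hx : x ∈ P), (ψ ⟨x, hP hx⟩ : S) = φ ⟨x, hx⟩) : φ ∈ E.Hom P Q :=
  E.hom_congr (φ := ψ.comp (Subgroup.inclusion hP)) (fun x => h x x.2)
    (E.comp_mem (E.inclusion_mem hP) hψ)

/-- `Aut_S(R)` is a Sylow `p`-subgroup of `Aut_F(R)`. -/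
def IsFullyAutomized (F : FusionSystem S) (p : ℕ) (R : Subgroup S) : Prop :=
  ∃ T : Sylow p (F.aut R), (T : Subgroup (F.aut R)) = (autS R).subgroupOf (F.aut R)

theorem IsCentric.isFullyCentralized [Finite S] {R : Subgroup S} (h : F.IsCentric R) :
    F.IsFullyCentralized R := by
  intro R' hR
  obtain ⟨e, -, -⟩ := hR.symm
  exact (card_centralizer_le e (h R' hR)).trans
    (Nat.card_le_card_of_injective _ (Subgroup.inclusion_injective inf_le_left))

theorem IsFullyCentralized.isCentric [Finite S] {R : Subgroup S} (h : F.IsFullyCentralized R)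
    (hR : Subgroup.centralizer (R : Set S) ≤ R) : F.IsCentric R := by
  intro R' hRR'
  obtain ⟨e, -, -⟩ := id hRR'
  have := (h R' hRR').trans (card_centralizer_le e hR)
  exact inf_eq_left.1 (Subgroup.eq_of_le_of_card_ge inf_le_left this)

theorem exists_isFullyNormalized [Finite S] (F : FusionSystem S) (P : Subgroup S) :
    ∃ R, F.Conj P R ∧ F.IsFullyNormalized R := by
  obtain ⟨R, hR, hmax⟩ := Set.exists_max_image {R | F.Conj P R} (fun R => Nat.card (nrm R))
    (Set.toFinite _) ⟨P, Conj.refl F P⟩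
  exact ⟨R, hR, fun R' hR' => hmax R' (Conj.trans hR hR')⟩

theorem lt_nrm {p : ℕ} [Fact p.Prime] [Finite S] (hS : IsPGroup p S) {P : Subgroup S}
    (hP : P ≠ ⊤) : P < nrm P := by
  have := hS.isNilpotent
  exact Group.normalizerCondition_of_isNilpotent P hP.lt_top

theorem card_lt_card_of_lt [Finite S] {P Q : Subgroup S} (h : P < Q) : Nat.card P < Nat.card Q := by
  refine lt_of_le_of_ne (Subgroup.card_le_of_le h.le) fun hc => h.ne ?_
  exact Subgroup.eq_of_le_of_card_ge h.le hc.ge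

/-- An isomorphism to a fully automized and fully centralized subgroup extends to the normalizer
after composition with an automorphism of the target. -/
theorem IsSaturated.exists_extension {p : ℕ} [Fact p.Prime] [Finite S] (hS : IsPGroup p S)
    (hF : F.IsSaturated p) {P R : Subgroup S} (hRa : F.IsFullyAutomized p R)
    (hRc : F.IsFullyCentralized R) (hPR : F.Conj P R) :
    ∃ e : P ≃* R, e.toMonoidHom ∈ F.Hom P R ∧ ∃ ψ ∈ F.Hom (nrm P) ⊤,
      ∀ (x : S) (hx : x ∈ P), (ψ ⟨x, Subgroup.le_normalizer hx⟩ : S) = e ⟨x, hx⟩ := by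
  obtain ⟨e, he, -⟩ := hPR
  obtain ⟨T, hT⟩ := hRa
  have hp : IsPGroup p (((autS P).map (MulAut.congr e).toMonoidHom).subgroupOf (F.aut R)) :=
    (((hS.to_subgroup _).of_surjective _ P.normalizerMonoidHom.rangeRestrict_surjective).map
      _).comap_subtype
  -- `Aut_S(R)` is Sylow in `Aut_F(R)`, so some `χ` conjugates the transported `Aut_S(P)` into it.
  -- The extender of `χ ∘ e` is then all of `N_S(P)`.
  obtain ⟨χ, hχ⟩ := T.isSylowSubgroup.2.2 _ hp
  have he' : (e.trans χ.1).toMonoidHom ∈ F.Hom P R := trans_mem he χ.2.1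
  let φ : P →* (⊤ : Subgroup S) := (Subgroup.inclusion le_top).comp (e.trans χ.1).toMonoidHom
  have himg : image φ = R := by
    ext r
    constructor
    · rintro ⟨x, rfl⟩
      exact ((e.trans χ.1) x).2
    · intro hr
      exact ⟨(e.trans χ.1).symm ⟨r, hr⟩, congrArg Subtype.val
        ((e.trans χ.1).apply_symm_apply ⟨r, hr⟩)⟩
  obtain ⟨ψ, hψ, hψφ⟩ := hF.extend P φ (F.comp_mem he' (F.inclusion_mem le_top))
    (by rwa [himg])
  have hN : nrm P ≤ extender φ := by
    intro g hg
    let c : F.aut R := ⟨MulAut.congr e (P.normalizerMonoidHom ⟨g, hg⟩),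
      congr_mem_aut he (F.normalizerMonoidHom_mem_aut _)⟩
    have h1 : χ * c * χ⁻¹ ∈ (T : Subgroup (F.aut R)) := hχ c ⟨_, ⟨⟨g, hg⟩, rfl⟩, rfl⟩
    rw [hT] at h1
    obtain ⟨h, hh⟩ := h1
    refine ⟨hg, h, by rw [himg]; exact h.2, fun x => ?_⟩
    have h2 := congrArg Subtype.val (DFunLike.congr_fun hh (χ.1 (e x)))
    have h3 : (χ * c * χ⁻¹).1 (χ.1 (e x)) = χ.1 (e (P.normalizerMonoidHom ⟨g, hg⟩ x)) := by
      change χ.1 (e (P.normalizerMonoidHom ⟨g, hg⟩ (e.symm (χ.1⁻¹ (χ.1 (e x)))))) = _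
      simp
    exact (h2.trans (congrArg Subtype.val h3)).symm
  refine ⟨e.trans χ.1, he', ψ.comp (Subgroup.inclusion hN),
    F.comp_mem (F.inclusion_mem hN) hψ, fun x hx => ?_⟩
  exact congrArg Subtype.val (hψφ x hx (hN (Subgroup.le_normalizer hx)))

end FusionSystem
end Automizers


/-! ### The Alperin–Goldschmidt fusion theorem. -/

section Alperin

namespace FusionSystem

variable {S : Type u} [Group S] {F E : FusionSystem S}

/-- An automorphism of `R` that conjugates some automorphism induced by an element outside `R` to
an automorphism induced by `S` extends to a larger subgroup. -/
theorem IsSaturated.mem_aut_of_conj {p : ℕ} [Finite S] (hF : F.IsSaturated p) {R : Subgroup S}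
    (hRc : F.IsFullyCentralized R)
    (hE : ∀ P' : Subgroup S, Nat.card R < Nat.card P' → F.Hom P' ⊤ ⊆ E.Hom P' ⊤)
    {α : MulAut R} (hα : α ∈ F.aut R) {g : S} (hg : g ∈ nrm R) (hgR : g ∉ R)
    (h : α * R.normalizerMonoidHom ⟨g, hg⟩ * α⁻¹ ∈ autS R) : α ∈ E.aut R := by
  let φ : R →* (⊤ : Subgroup S) := (Subgroup.inclusion le_top).comp (MulEquiv.toMonoidHom α)
  have himg : image φ = R := by
    ext r
    constructor
    · rintro ⟨x, rfl⟩
      exact (α x).2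
    · intro hr
      exact ⟨α⁻¹ ⟨r, hr⟩, congrArg Subtype.val (α.apply_symm_apply ⟨r, hr⟩)⟩
  obtain ⟨ψ, hψ, hψφ⟩ := hF.extend R φ
    (F.comp_mem (mem_aut_iff.1 hα) (F.inclusion_mem le_top)) (by rwa [himg])
  have hgE : g ∈ extender φ := by
    obtain ⟨k, hk⟩ := h
    refine ⟨hg, k, by rw [himg]; exact k.2, fun x => ?_⟩
    have h1 := congrArg Subtype.val (DFunLike.congr_fun hk (α x))
    have h2 : (α * R.normalizerMonoidHom ⟨g, hg⟩ * α⁻¹) (α x) =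
        α (R.normalizerMonoidHom ⟨g, hg⟩ x) := by
      simp
    exact (h1.trans (congrArg Subtype.val h2)).symm
  have hlt : R < extender φ :=
    lt_of_le_of_ne (le_extender φ) fun he => hgR (by rw [he]; exact hgE)
  exact mem_aut_iff.2 (mem_of_extends (hE _ (card_lt_card_of_lt hlt) hψ) hlt.le
    fun x hx => congrArg Subtype.val (hψφ x hx (hlt.le hx)))

/-- If `R` is centric and `Aut_E(R)` is proper in `Aut_F(R)`, its image in `Out_F(R)` is strongly
`p`-embedded: an automorphism fusing nontrivial elements of `Out_S(R)` extends to a larger subgroup,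
hence belongs to `E`. So `R` would be essential. -/
theorem IsSaturated.aut_le_of_not_isEssential {p : ℕ} [Fact p.Prime] [Finite S]
    (hS : IsPGroup p S) (hF : F.IsSaturated p) {R : Subgroup S} (hRn : F.IsFullyNormalized R)
    (hR : R ≠ ⊤) (hess : ¬ F.IsEssential p R)
    (hE : ∀ P' : Subgroup S, Nat.card R < Nat.card P' → F.Hom P' ⊤ ⊆ E.Hom P' ⊤) :
    F.aut R ≤ E.aut R := by
  have hRc := hF.fully_centralized R hRn
  by_cases hC : Subgroup.centralizer (R : Set S) ≤ R
  swap
  -- An element of `C_S(R)` outside `R` induces the identity, which every `α` conjugates to itself;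
  -- so every `α` extends.
  · obtain ⟨g, hgC, hgR⟩ := Set.not_subset.1 hC
    have hg : g ∈ nrm R := Subgroup.centralizer_le_normalizer _ hgC
    intro α hα
    refine hF.mem_aut_of_conj hRc hE hα hg hgR ?_
    have : R.normalizerMonoidHom ⟨g, hg⟩ = 1 := by
      rw [← MonoidHom.mem_ker, Subgroup.normalizerMonoidHom_ker]
      exact hgC
    rw [this]
    simp
  by_contra hle
  have hHt : (E.aut R).subgroupOf (F.aut R) ≠ ⊤ := by rwa [Ne, Subgroup.subgroupOf_eq_top]
  obtain ⟨T, hT⟩ := hF.sylow R hRn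
  let I : Subgroup (F.aut R) := (innerAut R).subgroupOf (F.aut R)
  let π : F.aut R →* F.Out R := QuotientGroup.mk' I
  have hπ : Function.Surjective π := QuotientGroup.mk'_surjective I
  have hIH : I ≤ (E.aut R).subgroupOf (F.aut R) := fun x hx =>
    autS_le_aut E R (innerAut_le_autS R hx)
  have hmem : ∀ κ : F.aut R, π κ ∈ ((E.aut R).subgroupOf (F.aut R)).map π → κ.1 ∈ E.aut R := by
    rintro κ ⟨η, hη, he⟩
    have h1 : η⁻¹ * κ ∈ I := QuotientGroup.eq.1 he
    exact (Subgroup.mul_mem_cancel_left _ (inv_mem hη)).1 (hIH h1)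
  refine hess ⟨hRc.isCentric hC, ((E.aut R).subgroupOf (F.aut R)).map π,
    isStronglyEmbedded_of_sylow (T.mapSurjective hπ) ?_ ?_ ?_ ?_⟩
  · rw [Sylow.coe_mapSurjective, hT]
    exact Subgroup.map_mono fun x hx => autS_le_aut E R hx
  · intro htop
    refine hHt (eq_top_iff.2 fun κ _ => hmem κ ?_)
    rw [htop]
    trivial
  · intro hbot
    obtain ⟨g, hg, hgR⟩ := SetLike.exists_of_lt (lt_nrm hS hR)
    let c : F.aut R := ⟨R.normalizerMonoidHom ⟨g, hg⟩, F.normalizerMonoidHom_mem_aut _⟩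
    have hc : c ∈ (T : Subgroup (F.aut R)) := by
      rw [hT]
      exact ⟨⟨g, hg⟩, rfl⟩
    have h1 : π c ∈ (T.mapSurjective hπ : Subgroup (F.Out R)) := ⟨c, hc, rfl⟩
    rw [hbot, Subgroup.mem_bot] at h1
    obtain ⟨r, hr⟩ : c ∈ I := (QuotientGroup.eq_one_iff c).1 h1
    -- If `g` acted on `R` as the element `r` of `R` does, `r⁻¹ * g` would lie in `C_S(R) ≤ R`,
    -- forcing `g ∈ R`.
    refine hgR ((Subgroup.mul_mem_cancel_left R (inv_mem r.2)).1 (hC ?_))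
    refine Subgroup.mem_centralizer_iff.2 fun x hx => ?_
    have h1 := DFunLike.congr_fun hr (⟨x, hx⟩ : R)
    have h2 : r * x * (r : S)⁻¹ = g * x * g⁻¹ := congrArg (fun z : R => (z : S)) h1
    have h3 : g * x = r * x * (r : S)⁻¹ * g := by rw [h2]; group
    calc x * ((r : S)⁻¹ * g) = (r : S)⁻¹ * (r * x * (r : S)⁻¹ * g) := by group
      _ = (r : S)⁻¹ * g * x := by rw [← h3, mul_assoc]
  · rintro k hk _ ⟨t, ht, rfl⟩ hkt
    obtain ⟨κ, rfl⟩ := hπ k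
    rw [SetLike.mem_coe, hT] at ht
    obtain ⟨⟨g, hg⟩, hgt⟩ := ht
    have hκ : κ.1 ∉ E.aut R := fun h => hk ⟨κ, h, rfl⟩
    have hgR : g ∈ R := by
      by_contra hgR
      refine hκ (hF.mem_aut_of_conj hRc hE κ.2 hg hgR ?_)
      rw [hgt]
      obtain ⟨t', ht', he⟩ := hkt
      rw [SetLike.mem_coe, hT] at ht'
      have h2 : π t' = π (κ * t * κ⁻¹) := he.trans (by simp only [map_mul, map_inv])
      have h1 : t'⁻¹ * (κ * t * κ⁻¹) ∈ I := QuotientGroup.eq.1 h2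
      exact (Subgroup.mul_mem_cancel_left _ (inv_mem ht')).1 (innerAut_le_autS R h1)
    refine (QuotientGroup.eq_one_iff t).2 ⟨⟨g, hgR⟩, ?_⟩
    change MulAut.conj _ = t.1
    rw [← Subgroup.coe_subtype, ← hgt]
    ext x
    rfl

/-- Alperin's fusion theorem in the form of Goldschmidt: a saturated fusion system is generated by
the automorphism groups of suitable representatives of its essential subgroups and of `S`. -/
theorem IsSaturated.le_of_aut_le {p : ℕ} [Fact p.Prime] [Finite S] (hS : IsPGroup p S)
    (hF : F.IsSaturated p) (X : Set (Subgroup S)) (htop : ⊤ ∈ X)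
    (hXa : ∀ R ∈ X, F.IsFullyAutomized p R) (hXc : ∀ R ∈ X, F.IsFullyCentralized R)
    (hess : ∀ R, F.IsEssential p R → ∃ R' ∈ X, F.Conj R R')
    (hE : ∀ R ∈ X, F.aut R ≤ E.aut R) : F.Le E := by
  intro P
  induction hk : Nat.card S - Nat.card P using Nat.strong_induction_on generalizing P with
  | _ k ih =>
  subst hk
  intro Q φ hφ
  have hIH : ∀ P' : Subgroup S, Nat.card P < Nat.card P' → F.Hom P' ⊤ ⊆ E.Hom P' ⊤ := by
    intro P' hP'
    refine ih _ ?_ P' rfl ⊤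
    have := Subgroup.card_le_card_group P'
    omega
  obtain ⟨R, hRQ, e, he, he', rfl⟩ := F.factor hφ
  refine E.comp_mem ?_ (E.inclusion_mem hRQ)
  have hcard : Nat.card P = Nat.card R := Nat.card_congr e.toEquiv
  rcases eq_or_ne P ⊤ with rfl | hP
  · obtain rfl : R = ⊤ := by
      rw [← Subgroup.card_eq_iff_eq_top, ← hcard, Subgroup.card_top]
    exact (hE ⊤ htop (mem_aut_iff.2 he)).1
  -- `Y` is a conjugate of `P` in `X` if there is one. Otherwise any fully normalized conjugate
  -- serves, since it is neither `S` nor essential.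
  obtain ⟨Y, hPY, hYa, hYc, hYE⟩ : ∃ Y, F.Conj P Y ∧ F.IsFullyAutomized p Y ∧
      F.IsFullyCentralized Y ∧ F.aut Y ≤ E.aut Y := by
    by_cases hX : ∃ Y ∈ X, F.Conj P Y
    · obtain ⟨Y, hY, hPY⟩ := hX
      exact ⟨Y, hPY, hXa Y hY, hXc Y hY, hE Y hY⟩
    · obtain ⟨Y, hPY, hYn⟩ := F.exists_isFullyNormalized P
      obtain ⟨f, -, -⟩ := id hPY
      have hPYc : Nat.card P = Nat.card Y := Nat.card_congr f.toEquiv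
      refine ⟨Y, hPY, hF.sylow Y hYn, hF.fully_centralized Y hYn,
        hF.aut_le_of_not_isEssential hS hYn ?_ ?_ (fun P' hP' => hIH P' (hPYc ▸ hP'))⟩
      · rintro rfl
        exact hX ⟨⊤, htop, hPY⟩
      · intro h
        obtain ⟨Y', hY', hYY'⟩ := hess Y h
        exact hX ⟨Y', hY', hPY.trans hYY'⟩
  have hR : R ≠ ⊤ := by
    rintro rfl
    rw [Subgroup.card_top] at hcard
    exact hP ((Subgroup.card_eq_iff_eq_top P).1 hcard)
  have key : ∀ P' : Subgroup S, Nat.card P = Nat.card P' → P' ≠ ⊤ → F.Conj P' Y →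
      ∃ f : P' ≃* Y, f.toMonoidHom ∈ F.Hom P' Y ∧ f.toMonoidHom ∈ E.Hom P' Y := by
    intro P' hc hP' hP'Y
    obtain ⟨f, hf, ψ, hψ, hψf⟩ := hF.exists_extension hS hYa hYc hP'Y
    exact ⟨f, hf, mem_of_extends (hIH _ (hc ▸ card_lt_card_of_lt (lt_nrm hS hP')) hψ)
      Subgroup.le_normalizer hψf⟩
  obtain ⟨f, hf, hfE⟩ := key P rfl hP hPY
  obtain ⟨f', hf', hfE'⟩ := key R hcard hR (Conj.trans ⟨e.symm, he', he⟩ hPY)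
  -- The maps from `P` and `R` to `Y` extend to normalizers, so they lie in `E` by induction; `e`
  -- differs from them only by the automorphism `a` of `Y`.
  let a : MulAut Y := f.symm.trans (e.trans f')
  have ha : a ∈ E.aut Y := hYE (mem_aut_iff.2 (trans_mem (symm_mem hf) (trans_mem he hf')))
  have hea : e = f.trans (MulEquiv.trans a f'.symm) := by
    ext x
    simp [a]
  rw [hea]
  exact trans_mem hfE (trans_mem (mem_aut_iff.1 ha) (symm_mem hfE'))

end FusionSystem
end Alperin


/-! ### The action of `L` on `P`. -/

section AlperinFamily

variable {S : Type u} [Group S] {L : Type u} [Group L] {P : Subgroup S} {θ : nrm P →* L}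

theorem exists_mulEquiv_copyIn (hθ : Function.Injective θ) :
    ∃ e : P ≃* copyIn P θ, ∀ x : P, (e x : L) = θ ⟨x, Subgroup.le_normalizer x.2⟩ :=
  ⟨(Subgroup.subgroupOfEquivOfLe Subgroup.le_normalizer).symm.trans
    (Subgroup.equivMapOfInjective _ θ hθ), fun _ => rfl⟩

/-- The action of `L` on `P` by conjugation, when the copy of `P` in `L` is normal. -/
theorem exists_conjAut (hθ : Function.Injective θ) (hn : (copyIn P θ).Normal) :
    ∃ c : L →* MulAut P, ∀ g (x : P), θ ⟨c g x, Subgroup.le_normalizer (c g x).2⟩ =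
      g * θ ⟨x, Subgroup.le_normalizer x.2⟩ * g⁻¹ := by
  obtain ⟨e, he⟩ := exists_mulEquiv_copyIn hθ
  refine ⟨(MulAut.congr e.symm).toMonoidHom.comp MulAut.conjNormal, fun g x => ?_⟩
  rw [← he, ← he, ← MulAut.conjNormal_apply]
  exact congrArg Subtype.val (e.apply_symm_apply _)

theorem conjAut_apply_hom (hθ : Function.Injective θ) {c : L →* MulAut P}
    (hc : ∀ g (x : P), θ ⟨c g x, Subgroup.le_normalizer (c g x).2⟩ =
      g * θ ⟨x, Subgroup.le_normalizer x.2⟩ * g⁻¹) (s : nrm P) :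
    c (θ s) = P.normalizerMonoidHom s := by
  ext x
  have h := hc (θ s) x
  rw [← map_mul, ← map_inv, ← map_mul] at h
  exact congrArg (fun z : nrm P => (z : S)) (hθ h)

theorem conjAut_ker {c : L →* MulAut P} (hθ : Function.Injective θ)
    (hc : ∀ g (x : P), θ ⟨c g x, Subgroup.le_normalizer (c g x).2⟩ =
      g * θ ⟨x, Subgroup.le_normalizer x.2⟩ * g⁻¹) :
    c.ker = Subgroup.centralizer (copyIn P θ : Set L) := by
  obtain ⟨e, he⟩ := exists_mulEquiv_copyIn hθ
  ext g
  rw [MonoidHom.mem_ker, Subgroup.mem_centralizer_iff]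
  constructor
  · intro hg y hy
    obtain ⟨x, hx⟩ := e.surjective ⟨y, hy⟩
    have h1 : θ ⟨x, Subgroup.le_normalizer x.2⟩ = y := by rw [← he, hx]
    have h2 := hc g x
    simp only [hg, MulAut.one_apply, h1] at h2
    exact eq_mul_inv_iff_mul_eq.1 h2
  · intro hg
    ext x
    have h1 := hg (e x) (e x).2
    rw [he] at h1
    have h2 := (hc g x).trans (eq_mul_inv_iff_mul_eq.2 h1).symm
    exact congrArg (fun z : nrm P => (z : S)) (hθ h2)

/-- The image lies in `Aut_F(P)`, so comparing orders is enough. The kernel `C_L(P)` has order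
`|Z(P)|`, and `|L| = |Out_F(P)| |P| = |Out_F(P)| |Inn(P)| |Z(P)| = |Aut_F(P)| |Z(P)|`. -/
theorem conjAut_range [Finite S] [Finite L] (hθ : Function.Injective θ) {F : FusionSystem S}
    {c : L →* MulAut P}
    (hc : ∀ g (x : P), θ ⟨c g x, Subgroup.le_normalizer (c g x).2⟩ =
      g * θ ⟨x, Subgroup.le_normalizer x.2⟩ * g⁻¹)
    (hC : Subgroup.centralizer (copyIn P θ : Set L) =
      (Subgroup.center (copyIn P θ)).map (copyIn P θ).subtype)
    (hn : (copyIn P θ).Normal) (hO : Nonempty ((L ⧸ copyIn P θ) ≃* F.Out P))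
    (hF : ∀ Q R : Subgroup S, subgroupFusion θ Q R ⊆ F.Hom Q R) :
    c.range = F.aut P := by
  have hle : c.range ≤ F.aut P := by
    rintro _ ⟨g, rfl⟩
    exact FusionSystem.mem_aut_iff.2
      (hF P P ⟨Subgroup.le_normalizer, Subgroup.le_normalizer, g, hc g⟩)
  refine Subgroup.eq_of_le_of_card_ge hle (le_of_eq ?_)
  obtain ⟨e, -⟩ := exists_mulEquiv_copyIn hθ
  obtain ⟨o⟩ := hO
  have hz : Nat.card c.ker = Nat.card (Subgroup.center P) := by
    rw [conjAut_ker hθ hc, hC, Nat.card_congr (Subgroup.centerCongr e).toEquiv]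
    exact (Nat.card_congr (Subgroup.equivMapOfInjective _ _
      (Subgroup.subtype_injective _)).toEquiv).symm
  have h1 : Nat.card L = Nat.card c.range * Nat.card c.ker := by
    rw [Subgroup.card_eq_card_quotient_mul_card_subgroup c.ker,
      Nat.card_congr (QuotientGroup.quotientKerEquivRange c).toEquiv]
  have h2 := Subgroup.card_eq_card_quotient_mul_card_subgroup (copyIn P θ)
  have h3 := Subgroup.card_eq_card_quotient_mul_card_subgroup
    ((innerAut P).subgroupOf (F.aut P))
  have hker : (MulAut.conj : P →* MulAut P).ker = Subgroup.center P := by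
    ext x
    rw [MonoidHom.mem_ker, Subgroup.mem_center_iff, DFunLike.ext_iff]
    simp only [MulAut.conj_apply, MulAut.one_apply, mul_inv_eq_iff_eq_mul]
    exact forall_congr' fun y => eq_comm
  have h4 : Nat.card P = Nat.card (innerAut P) * Nat.card (Subgroup.center P) := by
    rw [Subgroup.card_eq_card_quotient_mul_card_subgroup (MulAut.conj : P →* MulAut P).ker,
      Nat.card_congr (QuotientGroup.quotientKerEquivRange (MulAut.conj : P →* MulAut P)).toEquiv,
      hker]
    rfl
  rw [Nat.card_congr (Subgroup.subgroupOfEquivOfLe ((FusionSystem.innerAut_le_autS P).trans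
    (F.autS_le_aut P))).toEquiv, ← Nat.card_congr o.toEquiv] at h3
  rw [← Nat.card_congr e.toEquiv, h4, ← mul_assoc, ← h3, h1, hz] at h2
  exact (Nat.eq_of_mul_eq_mul_right Nat.card_pos h2).symm

/-- A surjection of finite groups maps Sylow subgroups to Sylow subgroups, and `N_S(P)` acts on `P`
in `L` as it does in `S`. -/
theorem isFullyAutomized_of_conjAut {p : ℕ} [Fact p.Prime] [Finite L] (hθ : Function.Injective θ)
    {F : FusionSystem S} {c : L →* MulAut P}
    (hc : ∀ g (x : P), θ ⟨c g x, Subgroup.le_normalizer (c g x).2⟩ =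
      g * θ ⟨x, Subgroup.le_normalizer x.2⟩ * g⁻¹)
    (hrange : c.range = F.aut P) (hT : ∃ T : Sylow p L, (T : Subgroup L) = θ.range) :
    F.IsFullyAutomized p P := by
  obtain ⟨T, hT⟩ := hT
  let c' : L →* F.aut P := c.codRestrict (F.aut P) fun g => hrange ▸ ⟨g, rfl⟩
  have hc' : Function.Surjective c' := by
    rintro ⟨a, ha⟩
    rw [← hrange] at ha
    obtain ⟨g, rfl⟩ := ha
    exact ⟨g, rfl⟩
  refine ⟨T.mapSurjective hc', ?_⟩
  rw [Sylow.coe_mapSurjective, hT]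
  ext a
  constructor
  · rintro ⟨_, ⟨s, rfl⟩, rfl⟩
    exact ⟨s, (conjAut_apply_hom hθ hc s).symm⟩
  · rintro ⟨s, hs⟩
    exact ⟨θ s, ⟨s, rfl⟩, Subtype.ext ((conjAut_apply_hom hθ hc s).trans hs)⟩

end AlperinFamily

/-! ### The amalgam of the `K i j` and the theorem. -/

section RobinsonAmalgam

variable {S : Type u} [Group S] {n : ℕ} (P : Fin n → Subgroup S) (L : Fin n → Type u)
  [∀ i, Group (L i)] (θ : ∀ i, nrm (P i) →* L i) {m : Fin n → ℕ}
  (K : ∀ i, Fin (m i) → Subgroup (L i)) (hK : ∀ i j, (θ i).range ≤ K i j)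
  {r : ℕ} (e : Fin (r + 1) ≃ Σ i, Fin (m i)) (he : nrm (P (e 0).1) = ⊤)

theorem exists_hom_robinsonAmalgam (q : Σ i, Fin (m i)) :
    ∃ f : K q.1 q.2 →* (robinsonAmalgam P L θ K hK e he).carrier,
      ∀ s, f (toSubgroupHom (θ q.1) (K q.1 q.2) (hK _ _) s) =
        (robinsonAmalgam P L θ K hK e he).ι s := by
  obtain ⟨k, rfl⟩ := e.surjective q
  induction k using Fin.cases with
  | zero =>
    obtain ⟨f, hf⟩ := GroupUnder.exists_iteratedAmalgamInl
      (GroupUnder.ofTop he (toSubgroupHom (θ (e 0).1) (K (e 0).1 (e 0).2) (hK _ _)))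
      (N := fun k : Fin r => nrm (P (e k.succ).1))
      (K := fun k : Fin r => K (e k.succ).1 (e k.succ).2)
      (fun k => toSubgroupHom (θ (e k.succ).1) (K (e k.succ).1 (e k.succ).2) (hK _ _))
    exact ⟨f, fun s => hf s⟩
  | succ k =>
    exact GroupUnder.exists_iteratedAmalgamInr _
      (N := fun k : Fin r => nrm (P (e k.succ).1))
      (K := fun k : Fin r => K (e k.succ).1 (e k.succ).2)
      (fun k => toSubgroupHom (θ (e k.succ).1) (K (e k.succ).1 (e k.succ).2) (hK _ _)) k

theorem toSubgroupHom_injective {N L : Type u} [Group N] [Group L] {θ : N →* L}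
    (hθ : Function.Injective θ) (K : Subgroup L) (h : θ.range ≤ K) :
    Function.Injective (toSubgroupHom θ K h) := fun _ _ hxy =>
  hθ (congrArg Subtype.val hxy)

theorem subgroupFusion_toSubgroupHom_subset {S L : Type u} [Group S] [Group L] {N : Subgroup S}
    (θ : N →* L) (K : Subgroup L) (h : θ.range ≤ K) (Q R : Subgroup S) :
    subgroupFusion (toSubgroupHom θ K h) Q R ⊆ subgroupFusion θ Q R := by
  rintro φ ⟨hQ, hR, g, hg⟩
  exact ⟨hQ, hR, g, fun x => congrArg Subtype.val (hg x)⟩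

theorem isSylowSubgroup_toSubgroupHom_range {p : ℕ} [Fact p.Prime] {N L : Type u} [Group N]
    [Group L] [Finite L] {θ : N →* L} (hT : ∃ T : Sylow p L, (T : Subgroup L) = θ.range)
    (K : Subgroup L) (h : θ.range ≤ K) : IsSylowSubgroup p (toSubgroupHom θ K h).range := by
  obtain ⟨T, hT⟩ := hT
  have := (T.subtype (hT ▸ h)).isSylowSubgroup
  convert this using 1
  ext x
  rw [Sylow.coe_subtype, Subgroup.mem_subgroupOf, hT]
  constructor
  · rintro ⟨s, rfl⟩
    exact ⟨s, rfl⟩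
  · rintro ⟨s, hs⟩
    exact ⟨s, Subtype.ext hs⟩

end RobinsonAmalgam

theorem mainTheorem1 {p : ℕ} [Fact p.Prime] {S : Type u} [Group S] [Finite S]
    (hS : IsPGroup p S) (F : FusionSystem S) (hF : F.IsSaturated p)
    {n : ℕ} [NeZero n] (P : Fin n → Subgroup S) (L : Fin n → Type u) [∀ i, Group (L i)]
    (θ : ∀ i, nrm (P i) →* L i) (hL : IsRobinsonFamily p F P L θ)
    {m : Fin n → ℕ} (K : ∀ i, Fin (m i) → Subgroup (L i))
    (hK : ∀ i j, (θ i).range ≤ K i j) (hgen : ∀ i, ⨆ j, K i j = ⊤)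
    {r : ℕ} (e : Fin (r + 1) ≃ Σ i, Fin (m i)) (he : nrm (P (e 0).1) = ⊤) :
    let G : GroupUnder S := robinsonAmalgam P L θ K hK e he
    ∃ hι : Function.Injective G.ι,
      IsSylowSubgroup p G.ι.range ∧ FusionSystem.ofGroup G.ι hι = F := by
  intro G
  have hfin := hL.finite
  have hinj : ∀ q : Σ i, Fin (m i),
      Function.Injective (toSubgroupHom (θ q.1) (K q.1 q.2) (hK _ _)) :=
    fun q => toSubgroupHom_injective (hL.injective _) _ _
  have hsyl : ∀ q : Σ i, Fin (m i),
      IsSylowSubgroup p (toSubgroupHom (θ q.1) (K q.1 q.2) (hK _ _)).range :=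
    fun q => isSylowSubgroup_toSubgroupHom_range (hL.sylow _) _ _
  have hfus : ∀ (q : Σ i, Fin (m i)) (Q R : Subgroup S),
      subgroupFusion (toSubgroupHom (θ q.1) (K q.1 q.2) (hK _ _)) Q R ⊆ F.Hom Q R :=
    fun q Q R => (subgroupFusion_toSubgroupHom_subset _ _ _ Q R).trans (hL.fusion_le _ Q R)
  let A := GroupUnder.ofTop he (toSubgroupHom (θ (e 0).1) (K (e 0).1 (e 0).2) (hK _ _))
  have hA : Function.Injective A.ι := fun x y hxy =>
    congrArg Subtype.val (hinj (e 0) hxy)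
  have hAS : IsSylowSubgroup p A.ι.range := by
    have h : A.ι.range = (toSubgroupHom (θ (e 0).1) (K (e 0).1 (e 0).2) (hK _ _)).range := by
      ext x
      constructor
      · rintro ⟨s, rfl⟩
        exact ⟨_, rfl⟩
      · rintro ⟨s, rfl⟩
        exact ⟨s, rfl⟩
    rw [h]
    exact hsyl (e 0)
  have hAF : (FusionSystem.ofGroup A.ι hA).Le F := by
    rintro Q R φ ⟨g, hg⟩
    exact hfus (e 0) Q R ⟨he ▸ le_top, he ▸ le_top, g, hg⟩
  have hι : Function.Injective G.ι :=
    GroupUnder.iteratedAmalgam_ι_injective A hA _ (fun k => hinj (e k.succ))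
  refine ⟨hι, GroupUnder.isSylowSubgroup_iteratedAmalgam hS A hA hAS _
    (fun k => hinj (e k.succ)) (fun k => hsyl (e k.succ)), ?_⟩
  have hle : (FusionSystem.ofGroup G.ι hι).Le F :=
    GroupUnder.ofGroup_iteratedAmalgam_le A hA hAF _ (fun k => hinj (e k.succ))
      (fun k => hfus (e k.succ)) hι
  have haut : ∀ i, F.IsFullyAutomized p (P i) ∧
      F.aut (P i) ≤ (FusionSystem.ofGroup G.ι hι).aut (P i) := by
    intro i
    obtain ⟨c, hc⟩ := exists_conjAut (hL.injective i) (hL.isPCore i).normal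
    obtain ⟨hn, hO⟩ := hL.quotient_iso i
    have hrange := conjAut_range (hL.injective i) hc (hL.centralizer_eq i) hn hO (hL.fusion_le i)
    refine ⟨isFullyAutomized_of_conjAut (hL.injective i) hc hrange (hL.sylow i), ?_⟩
    -- The elements of `L i` whose action on `P i` is induced by `G` form a subgroup. It contains
    -- every `K i j`, hence is all of `L i`.
    have htop : ⨆ j, K i j ≤ ((FusionSystem.ofGroup G.ι hι).aut (P i)).comap c := by
      refine iSup_le fun j g hg => FusionSystem.mem_aut_iff.2 ?_
      obtain ⟨f, hf⟩ := exists_hom_robinsonAmalgam P L θ K hK e he ⟨i, j⟩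
      refine ⟨f ⟨g, hg⟩, fun x => ?_⟩
      have h1 := hf ⟨x, Subgroup.le_normalizer x.2⟩
      have h2 := hf ⟨c g x, Subgroup.le_normalizer (c g x).2⟩
      refine h2.symm.trans ?_
      rw [← h1, ← map_inv, ← map_mul, ← map_mul]
      exact congrArg f (Subtype.ext (hc g x))
    rw [← hrange]
    rintro _ ⟨g, rfl⟩
    exact htop (hgen i ▸ Subgroup.mem_top g)
  have hge : F.Le (FusionSystem.ofGroup G.ι hι) :=
    hF.le_of_aut_le hS (Set.range P) ⟨0, hL.first⟩
      (by rintro _ ⟨i, rfl⟩; exact (haut i).1)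
      (by rintro _ ⟨i, rfl⟩; exact (hL.centric i).isFullyCentralized)
      (fun R hR => by
        obtain ⟨i, hi⟩ := hL.essential R hR
        exact ⟨_, ⟨i, rfl⟩, hi⟩)
      (by rintro _ ⟨i, rfl⟩; exact (haut i).2)
  ext Q R φ
  exact ⟨fun h => hle Q R h, fun h => hge Q R h⟩
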